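/- Consider the $\pi$-calculus with processes $P ::= {!G} \mid P|Q \mid (\nu a)P \mid G$ and guarded sums $G ::= 0 \mid \bar a\langle b\rangle.P \mid a(b).P \mid \tau.P \mid G+G'$, over countably infinitely many names and up to $\alpha$-equivalence, with its early labelled transition system $P\xrightarrow{\mu}P'$, where $\mu$ is a free output $\bar a b$, a bound output $\bar a(b)$, an input $a\,b$, or $\tau$. For a relation $\mathcal R$ on processes let $s(\mathcal R)=\{(P,Q) : \text{whenever } P\xrightarrow{\mu}P' \text{ with } \mathrm{bn}(\mu)\cap \mathrm{fn}(Q)=\emptyset, \text{ there is } Q' \text{ with } Q\xrightarrow{\mu}Q' \text{ and } (P',Q')\in\mathcal R\}$, $\;b(\mathcal R)=s(\mathcal R)\cap (s(\mathcal R^{-1}))^{-1}$, $\;\bar b(\mathcal R)=\mathcal R\cap b(\mathcal R)$, and let strong bisimilarity $\sim$ be the largest $\mathcal R$ with $\mathcal R\subseteq b(\mathcal R)$. Let $\mathcal P$ be a set of processes that is closed under transitions and has the aliased communication property: for all $P\in\mathcal P$, all names $a,b,c$ and all substitutions $\sigma$ with $a\sigma=c\sigma$, (i) if $P\xrightarrow{\bar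 a b}\xrightarrow{c\,b}P'$, then $P\sigma\xrightarrow{\tau}Q$ for some $Q\sim P'\sigma$; (ii) if $P\xrightarrow{\bar a(b)}\xrightarrow{c\,b}P'$ with $c\neq b$, then $P\sigma\xrightarrow{\tau}Q$ for some $Q\sim((\nu b)P')\sigma$. For relations $\mathcal R\subseteq\mathcal P\times\mathcal P$ let $F(\mathcal R)$ consist of the pairs in $\mathcal P\times\mathcal P$ that belong to the union of: ${\sim}\mathcal R{\sim}$; $\mathcal R$; $\{(P,P)\}$; $\{(P\sigma,Q\sigma) : P\,\mathcal R\,Q\}$ with $\sigma$ any substitution; $\{((\nu\tilde a)P,(\nu\tilde a)Q) : P\,\mathcal R\,Q\}$; $\{(P|P',Q|Q') : P\,\mathcal R\,Q,\ P'\,\mathcal R\,Q'\}$; $\{(G_1+G_2,G_1'+G_2') : G_1\,\mathcal R\,G_1',\ G_2\,\mathcal R\,G_2'\}$; $\{(!G,!G') : G\,\mathcal R\,G'\}$; $\{(\tau.P,\tau.Q) : P\,\mathcal R\,Q\}$; $\{(\bar a\langle b\rangle.P,\bar a\langle b\rangle.Q) : P\,\mathcal R\,Q\}$; $\{(a(b).P,a(b).Q)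 : P\,\mathcal R\,Q\}$. Let $F^\omega(\mathcal R)=\bigcup_{n\ge 0}F^n(\mathcal R)$. Then $F^\omega$ is $\bar b$-sound: there is a function $f'$ on the relations over $\mathcal P$ with $\mathcal R\subseteq f'(\mathcal R)$ for all $\mathcal R\subseteq\mathcal P\times\mathcal P$, such that for all $\mathcal R\subseteq\mathcal P\times\mathcal P$, $\mathcal R\subseteq\bar b(F^\omega(\mathcal R))$ implies $f'(\mathcal R)\subseteq\bar b(f'(\mathcal R))$ (so that in particular $\mathcal R\subseteq{\sim}$). -/

import Mathlib

/-! The pi-calculus: syntax, early labelled transition system, strong bisimilarity and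
up-to techniques on relations between processes. -/

namespace PiCalc

/-! ### Syntax

Names are natural numbers. Binders are in de Bruijn style, so that alpha-equivalent processes
are equal: in the body of a restriction or of an input prefix, `0` is the bound name and
`k + 1` is the name called `k` outside. The named binders of the usual syntax are recovered as
`Proc.nu` and `GSum.input` below. -/

mutual
/-- Processes `P ::= !G | P|Q | (ν a)P | G`. -/
inductive Proc : Type
  | ofSum (G : GSum) : Proc
  | rep (G : GSum) : Proc
  | par (P Q : Proc) : Proc
  | res (P : Proc) : Proc
/-- Guarded sums `G ::= 0 | a⟨b⟩.P | a(x).P | τ.P | G+G'`. -/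
inductive GSum : Type
  | nil : GSum
  | out (a b : ℕ) (P : Proc) : GSum
  | inp (a : ℕ) (P : Proc) : GSum
  | tau (P : Proc) : GSum
  | sum (G H : GSum) : GSum
end

/-- The action of a name substitution inside the scope of a binder. -/
def lift (σ : ℕ → ℕ) : ℕ → ℕ
  | 0 => 0
  | k + 1 => σ k + 1

mutual
/-- `P.subst σ` is the (capture-avoiding) substitution `Pσ`. -/
def Proc.subst : (ℕ → ℕ) → Proc → Proc
  | σ, .ofSum G => .ofSum (GSum.subst σ G)
  | σ, .rep G => .rep (GSum.subst σ G)
  | σ, .par P Q => .par (Proc.subst σ P) (Proc.subst σ Q)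
  | σ, .res P => .res (Proc.subst (lift σ) P)
/-- `G.subst σ` is the (capture-avoiding) substitution `Gσ`. -/
def GSum.subst : (ℕ → ℕ) → GSum → GSum
  | _, .nil => .nil
  | σ, .out a b P => .out (σ a) (σ b) (Proc.subst σ P)
  | σ, .inp a P => .inp (σ a) (Proc.subst (lift σ) P)
  | σ, .tau P => .tau (Proc.subst σ P)
  | σ, .sum G H => .sum (GSum.subst σ G) (GSum.subst σ H)
end

mutual
/-- Free names of a process. -/
def Proc.fn : Proc → Set ℕ
  | .ofSum G => GSum.fn G
  | .rep G => GSum.fn G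
  | .par P Q => Proc.fn P ∪ Proc.fn Q
  | .res P => {k | k + 1 ∈ Proc.fn P}
/-- Free names of a guarded sum. -/
def GSum.fn : GSum → Set ℕ
  | .nil => ∅
  | .out a b P => {a, b} ∪ Proc.fn P
  | .inp a P => {a} ∪ {k | k + 1 ∈ Proc.fn P}
  | .tau P => Proc.fn P
  | .sum G H => GSum.fn G ∪ GSum.fn H
end

/-- Instantiation: the body `P` of a binder, with `c` for the bound name. -/
def Proc.inst (c : ℕ) (P : Proc) : Proc :=
  P.subst (fun x => match x with
    | 0 => c
    | k + 1 => k)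

/-- Abstraction: `P` as the body of a binder that binds the name `b`. -/
def Proc.close (b : ℕ) (P : Proc) : Proc :=
  P.subst (fun x => if x = b then 0 else x + 1)

/-- The restriction `(ν b)P`, for a name `b` of `P`. -/
def Proc.nu (b : ℕ) (P : Proc) : Proc := .res (P.close b)

/-- The restriction `(ν a₁) … (ν aₙ)P`. -/
def Proc.nus (l : List ℕ) (P : Proc) : Proc := l.foldr Proc.nu P

/-- The input prefix `a(b).P`, for a name `b` of `P`. -/
def GSum.input (a b : ℕ) (P : Proc) : GSum := .inp a (P.close b)

/-! ### Transitions -/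

/-- Actions: free output, bound output, (early) input and the internal action. -/
inductive Act : Type
  | out (a b : ℕ) : Act
  | bout (a b : ℕ) : Act
  | inp (a b : ℕ) : Act
  | tau : Act

/-- Bound names of an action. -/
def Act.bn : Act → Set ℕ
  | .bout _ b => {b}
  | _ => ∅

/-- The action, as seen in the scope of a binder (whose bound name `0` it does not contain). -/
def Act.shift : Act → Act
  | .out a b => .out (a + 1) (b + 1)
  | .bout a b => .bout (a + 1) (b + 1)
  | .inp a b => .inp (a + 1) (b + 1)
  | .tau => .tau

/-- The early labelled transition system. -/
inductive Trans : Proc → Act → Proc → Prop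
  | inp (a c : ℕ) (P : Proc) : Trans (.ofSum (.inp a P)) (.inp a c) (P.inst c)
  | out (a b : ℕ) (P : Proc) : Trans (.ofSum (.out a b P)) (.out a b) P
  | tau (P : Proc) : Trans (.ofSum (.tau P)) .tau P
  | sumL {G : GSum} {μ : Act} {P' : Proc} (H : GSum) :
      Trans (.ofSum G) μ P' → Trans (.ofSum (.sum G H)) μ P'
  | sumR {H : GSum} {μ : Act} {P' : Proc} (G : GSum) :
      Trans (.ofSum H) μ P' → Trans (.ofSum (.sum G H)) μ P'
  | rep {G : GSum} {μ : Act} {P' : Proc} :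
      Trans (.par (.rep G) (.ofSum G)) μ P' → Trans (.rep G) μ P'
  | res {P : Proc} {μ : Act} {P' : Proc} :
      Trans P μ.shift P' → Trans (.res P) μ (.res P')
  | opn {P : Proc} {a b : ℕ} {P' : Proc} :
      Trans P (.out (a + 1) 0) P' → b ∉ (Proc.res P).fn →
        Trans (.res P) (.bout a b) (P'.inst b)
  | parL {P : Proc} {μ : Act} {P' : Proc} (Q : Proc) :
      Trans P μ P' → Disjoint μ.bn Q.fn → Trans (.par P Q) μ (.par P' Q)
  | parR {Q : Proc} {μ : Act} {Q' : Proc} (P : Proc) :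
      Trans Q μ Q' → Disjoint μ.bn P.fn → Trans (.par P Q) μ (.par P Q')
  | commL {P Q : Proc} {a b : ℕ} {P' Q' : Proc} :
      Trans P (.inp a b) P' → Trans Q (.out a b) Q' → Trans (.par P Q) .tau (.par P' Q')
  | commR {P Q : Proc} {a b : ℕ} {P' Q' : Proc} :
      Trans P (.out a b) P' → Trans Q (.inp a b) Q' → Trans (.par P Q) .tau (.par P' Q')
  | closeL {P Q : Proc} {a b : ℕ} {P' Q' : Proc} :
      Trans P (.inp a b) P' → Trans Q (.bout a b) Q' → b ∉ P.fn →
        Trans (.par P Q) .tau (Proc.nu b (.par P' Q'))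
  | closeR {P Q : Proc} {a b : ℕ} {P' Q' : Proc} :
      Trans P (.bout a b) P' → Trans Q (.inp a b) Q' → b ∉ Q.fn →
        Trans (.par P Q) .tau (Proc.nu b (.par P' Q'))

/-! ### Strong bisimilarity -/

/-- Relations between processes. -/
abbrev Rel : Type := Set (Proc × Proc)

/-- The converse relation. -/
def conv (R : Rel) : Rel := {X | (X.2, X.1) ∈ R}

/-- The simulation function; bound names of actions are fresh for both processes (for the first
one this holds for every transition). -/
def s (R : Rel) : Rel :=
  {X | ∀ (μ : Act) (P' : Proc), Trans X.1 μ P' → Disjoint μ.bn X.2.fn →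
    ∃ Q' : Proc, Trans X.2 μ Q' ∧ (P', Q') ∈ R}

/-- The bisimulation function. -/
def b (R : Rel) : Rel := s R ∩ conv (s (conv R))

/-- The respectful variant of the bisimulation function. -/
def bbar (R : Rel) : Rel := R ∩ b R

/-- Strong bisimilarity, the largest `R` with `R ⊆ b R`. -/
def bisimilarity : Rel := ⋃₀ {R | R ⊆ b R}

/-! ### Up-to techniques -/

/-- `R ↦ S R S⁻¹`. -/
def upTo (S R : Rel) : Rel :=
  {X | ∃ P Q : Proc, (X.1, P) ∈ S ∧ (P, Q) ∈ R ∧ (X.2, Q) ∈ S}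

def refl (_ : Rel) : Rel := {X | ∃ P : Proc, X = (P, P)}

def sub (R : Rel) : Rel :=
  {X | ∃ (P Q : Proc) (σ : ℕ → ℕ), (P, Q) ∈ R ∧ X = (P.subst σ, Q.subst σ)}

def res (R : Rel) : Rel :=
  {X | ∃ (P Q : Proc) (l : List ℕ), (P, Q) ∈ R ∧ X = (Proc.nus l P, Proc.nus l Q)}

def pcomp (R : Rel) : Rel :=
  {X | ∃ P Q P' Q' : Proc, (P, Q) ∈ R ∧ (P', Q') ∈ R ∧ X = (.par P P', .par Q Q')}

def sum (R : Rel) : Rel :=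
  {X | ∃ G₁ G₂ G₁' G₂' : GSum, (Proc.ofSum G₁, Proc.ofSum G₁') ∈ R ∧
    (Proc.ofSum G₂, Proc.ofSum G₂') ∈ R ∧ X = (.ofSum (.sum G₁ G₂), .ofSum (.sum G₁' G₂'))}

def rep (R : Rel) : Rel :=
  {X | ∃ G G' : GSum, (Proc.ofSum G, Proc.ofSum G') ∈ R ∧ X = (.rep G, .rep G')}

def tau (R : Rel) : Rel :=
  {X | ∃ P Q : Proc, (P, Q) ∈ R ∧ X = (.ofSum (.tau P), .ofSum (.tau Q))}

def out (R : Rel) : Rel :=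
  {X | ∃ (P Q : Proc) (a b : ℕ), (P, Q) ∈ R ∧ X = (.ofSum (.out a b P), .ofSum (.out a b Q))}

def inp (R : Rel) : Rel :=
  {X | ∃ (P Q : Proc) (a b : ℕ), (P, Q) ∈ R ∧
    X = (.ofSum (GSum.input a b P), .ofSum (GSum.input a b Q))}

/-- Up to bisimilarity and context, as a function on the relations over the processes in `C`:
only pairs of processes in `C` are kept. -/
def fullContext (C : Set Proc) (R : Rel) : Rel :=
  (upTo bisimilarity R ∪ R ∪ refl R ∪ sub R ∪ res R ∪ pcomp R ∪ sum R ∪ rep R ∪ tau R ∪ out R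
    ∪ inp R) ∩ C ×ˢ C

/-- The iteration `f^ω`, the union of all `fⁿ`. -/
def omega (f : Rel → Rel) (R : Rel) : Rel := ⋃ n : ℕ, f^[n] R

/-- For functions on the relations over `C`: `f` is `g`-sound via `f'`. -/
def SoundVia (C : Set Proc) (g f f' : Rel → Rel) : Prop :=
  (∀ R ⊆ C ×ˢ C, R ⊆ f' R ∧ f' R ⊆ C ×ˢ C) ∧
    ∀ R ⊆ C ×ˢ C, R ⊆ g (f R) → f' R ⊆ g (f' R)

/-- For functions on the relations over `C`: `f` is `g`-sound. -/
def Sound (C : Set Proc) (g f : Rel → Rel) : Prop := ∃ f' : Rel → Rel, SoundVia C g f f'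

/-! ### Subcalculi -/

/-- The set `C` of processes is closed under transitions. -/
def IsSubcalculus (C : Set Proc) : Prop :=
  ∀ P ∈ C, ∀ (μ : Act) (P' : Proc), Trans P μ P' → P' ∈ C

/-- The aliased communication property. The residual of the internal step is only required to
be bisimilar to `P'σ`, respectively to `((ν b)P')σ`, instead of equal. In the second clause `b` is
a bound name, so `σ` acts on `(ν b)P'` and the subject `c` is not `b`. -/
def AliasedCommunication (C : Set Proc) : Prop :=
  ∀ P ∈ C, ∀ (a b c : ℕ) (P₁ P' : Proc) (σ : ℕ → ℕ), σ a = σ c →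
    (Trans P (.out a b) P₁ → Trans P₁ (.inp c b) P' →
      ∃ Q : Proc, Trans (P.subst σ) .tau Q ∧ (Q, P'.subst σ) ∈ bisimilarity) ∧
    (c ≠ b → Trans P (.bout a b) P₁ → Trans P₁ (.inp c b) P' →
      ∃ Q : Proc, Trans (P.subst σ) .tau Q ∧ (Q, (Proc.nu b P').subst σ) ∈ bisimilarity)

end PiCalc

-- The witness `f'` sends `R` to the pairs over `C` in the contextual closure `Ctx C R`. This is an
-- equivalence containing `R` and bisimilarity, closed under contexts and injective renamings;
-- closure under arbitrary substitutions and input prefixes is imposed only on pairs of processes in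
-- `C`. It contains every iterate of `fullContext C` on `R`, so the hypothesis gives that `R`
-- progresses to `Ctx C R`, and it remains to see that `Ctx C R` is a bisimulation. The induction on
-- the closure is `Ctx.sim`.
--
-- The critical case is substitution, to which input prefixes reduce once a name is received.
-- Visible transitions of `Pσ` come from those of `P` (`Step.of_subst`). An internal one may be new:
-- `σ` can identify the subjects `a` and `c` of an output and an input of `P`. By
-- `Step.tau_of_subst`, `P` then performs the output followed by the input, and the residuals agree
-- up to commutativity, scope extrusion and exchange of restrictions, which are sound for
-- bisimilarity (`StructCong.mem_bisimilarity`). `Q` answers the two actions in turn, and the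
-- aliased communication property contracts the answers into one internal step of `Qσ`.
--
-- The second answer concerns a pair of residuals that is an arbitrary member of `Ctx C R`, out of
-- reach of the induction hypothesis. Hence there are two inductions. The first treats visible
-- transitions only; it is self-contained, because visible transitions of a compound process arise
-- from visible ones of its parts. The second treats all transitions and takes the second answer
-- from the first.
--
-- All this is carried out for `Step`, where residuals of inputs and bound outputs are bodies of
-- binders and no freshness conditions occur; `Trans.spec` and `Step.spec` translate to and from the
-- early system.

namespace PiCalc

/-! ### Substitutions and free names -/

/-- The substitution of `c` for the name bound by the outermost binder. -/
def instFun (c : ℕ) : ℕ → ℕ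
  | 0 => c
  | k + 1 => k

/-- The substitution that turns the name `b` into a bound name. -/
def closeFun (b : ℕ) (x : ℕ) : ℕ := if x = b then 0 else x + 1

/-- Exchange of the names bound by the two outermost binders. -/
def swap : ℕ → ℕ
  | 0 => 1
  | 1 => 0
  | k + 2 => k + 2

@[simp] theorem instFun_zero (c : ℕ) : instFun c 0 = c := rfl
@[simp] theorem instFun_succ (c k : ℕ) : instFun c (k + 1) = k := rfl
@[simp] theorem lift_zero (σ : ℕ → ℕ) : lift σ 0 = 0 := rfl
@[simp] theorem lift_succ (σ : ℕ → ℕ) (k : ℕ) : lift σ (k + 1) = σ k + 1 := rfl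
@[simp] theorem swap_zero : swap 0 = 1 := rfl
@[simp] theorem swap_one : swap 1 = 0 := rfl
@[simp] theorem swap_add_two (k : ℕ) : swap (k + 2) = k + 2 := rfl

@[simp] theorem swap_swap (x : ℕ) : swap (swap x) = x := by
  rcases x with _ | _ | x <;> rfl

theorem swap_injective : Function.Injective swap :=
  Function.LeftInverse.injective swap_swap

theorem closeFun_injective (b : ℕ) : Function.Injective (closeFun b) := by
  intro x y h
  unfold closeFun at h
  split_ifs at h <;> omega

theorem Proc.inst_eq (c : ℕ) (P : Proc) : P.inst c = P.subst (instFun c) := by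
  unfold Proc.inst
  congr 1

theorem Proc.close_eq (b : ℕ) (P : Proc) : P.close b = P.subst (closeFun b) := rfl

theorem lift_comp (σ τ : ℕ → ℕ) : lift τ ∘ lift σ = lift (τ ∘ σ) := by
  funext x
  cases x <;> rfl

theorem lift_id : lift id = id := by
  funext x
  cases x <;> rfl

mutual
theorem Proc.subst_subst : ∀ (P : Proc) (σ τ : ℕ → ℕ),
    (P.subst σ).subst τ = P.subst (τ ∘ σ)
  | .ofSum G, σ, τ => by simp only [Proc.subst, GSum.subst_subst G]
  | .rep G, σ, τ => by simp only [Proc.subst, GSum.subst_subst G]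
  | .par P Q, σ, τ => by simp only [Proc.subst, Proc.subst_subst P, Proc.subst_subst Q]
  | .res P, σ, τ => by simp only [Proc.subst, Proc.subst_subst P, lift_comp]
theorem GSum.subst_subst : ∀ (G : GSum) (σ τ : ℕ → ℕ),
    (G.subst σ).subst τ = G.subst (τ ∘ σ)
  | .nil, _, _ => rfl
  | .out a b P, σ, τ => by simp only [GSum.subst, Proc.subst_subst P, Function.comp]
  | .inp a P, σ, τ => by simp only [GSum.subst, Proc.subst_subst P, lift_comp, Function.comp]
  | .tau P, σ, τ => by simp only [GSum.subst, Proc.subst_subst P]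
  | .sum G H, σ, τ => by simp only [GSum.subst, GSum.subst_subst G, GSum.subst_subst H]
end

theorem lift_eqOn {σ τ : ℕ → ℕ} {S : Set ℕ} (h : Set.EqOn σ τ {k | k + 1 ∈ S}) :
    Set.EqOn (lift σ) (lift τ) S := by
  intro x hx
  cases x with
  | zero => rfl
  | succ k => simp [h hx]

mutual
theorem Proc.subst_congr : ∀ (P : Proc) {σ τ : ℕ → ℕ}, Set.EqOn σ τ P.fn →
    P.subst σ = P.subst τ
  | .ofSum G, _, _, h => by simp only [Proc.subst, GSum.subst_congr G h]
  | .rep G, _, _, h => by simp only [Proc.subst, GSum.subst_congr G h]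
  | .par P Q, _, _, h => by
    simp only [Proc.subst, Proc.subst_congr P (h.mono Set.subset_union_left),
      Proc.subst_congr Q (h.mono Set.subset_union_right)]
  | .res P, _, _, h => by simp only [Proc.subst, Proc.subst_congr P (lift_eqOn h)]
theorem GSum.subst_congr : ∀ (G : GSum) {σ τ : ℕ → ℕ}, Set.EqOn σ τ G.fn →
    G.subst σ = G.subst τ
  | .nil, _, _, _ => rfl
  | .out a b P, _, _, h => by
    simp only [GSum.subst, Proc.subst_congr P (h.mono Set.subset_union_right),
      h (show a ∈ GSum.fn (.out a b P) by simp [GSum.fn]),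
      h (show b ∈ GSum.fn (.out a b P) by simp [GSum.fn])]
  | .inp a P, _, _, h => by
    simp only [GSum.subst, Proc.subst_congr P (lift_eqOn (h.mono Set.subset_union_right)),
      h (show a ∈ GSum.fn (.inp a P) by simp [GSum.fn])]
  | .tau P, _, _, h => by simp only [GSum.subst, Proc.subst_congr P h]
  | .sum G H, _, _, h => by
    simp only [GSum.subst, GSum.subst_congr G (h.mono Set.subset_union_left),
      GSum.subst_congr H (h.mono Set.subset_union_right)]
end

mutual
theorem Proc.subst_id : ∀ P : Proc, P.subst id = P
  | .ofSum G => by simp only [Proc.subst, GSum.subst_id G]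
  | .rep G => by simp only [Proc.subst, GSum.subst_id G]
  | .par P Q => by simp only [Proc.subst, Proc.subst_id P, Proc.subst_id Q]
  | .res P => by simp only [Proc.subst, lift_id, Proc.subst_id P]
theorem GSum.subst_id : ∀ G : GSum, G.subst id = G
  | .nil => rfl
  | .out a b P => by simp only [GSum.subst, Proc.subst_id P, id]
  | .inp a P => by simp only [GSum.subst, Proc.subst_id P, lift_id, id]
  | .tau P => by simp only [GSum.subst, Proc.subst_id P]
  | .sum G H => by simp only [GSum.subst, GSum.subst_id G, GSum.subst_id H]
end

theorem Proc.subst_eq_self {P : Proc} {σ : ℕ → ℕ} (h : Set.EqOn σ id P.fn) : P.subst σ = P :=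
  (P.subst_congr h).trans P.subst_id

theorem lift_image (σ : ℕ → ℕ) (S : Set ℕ) :
    {k | k + 1 ∈ lift σ '' S} = σ '' {k | k + 1 ∈ S} := by
  ext k
  constructor
  · rintro ⟨x, hx, h⟩
    cases x with
    | zero => simp at h
    | succ x => exact ⟨x, hx, by simpa using h⟩
  · rintro ⟨x, hx, rfl⟩
    exact ⟨x + 1, hx, rfl⟩

mutual
theorem Proc.fn_subst : ∀ (P : Proc) (σ : ℕ → ℕ), (P.subst σ).fn = σ '' P.fn
  | .ofSum G, σ => by simp only [Proc.subst, Proc.fn, GSum.fn_subst G]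
  | .rep G, σ => by simp only [Proc.subst, Proc.fn, GSum.fn_subst G]
  | .par P Q, σ => by
    simp only [Proc.subst, Proc.fn, Proc.fn_subst P, Proc.fn_subst Q, Set.image_union]
  | .res P, σ => by simp only [Proc.subst, Proc.fn, Proc.fn_subst P, lift_image]
theorem GSum.fn_subst : ∀ (G : GSum) (σ : ℕ → ℕ), (G.subst σ).fn = σ '' G.fn
  | .nil, _ => by simp [GSum.subst, GSum.fn]
  | .out a b P, σ => by
    simp only [GSum.subst, GSum.fn, Proc.fn_subst P, Set.image_union, Set.image_pair]
  | .inp a P, σ => by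
    simp only [GSum.subst, GSum.fn, Proc.fn_subst P, Set.image_union, Set.image_singleton,
      lift_image]
  | .tau P, σ => by simp only [GSum.subst, GSum.fn, Proc.fn_subst P]
  | .sum G H, σ => by
    simp only [GSum.subst, GSum.fn, GSum.fn_subst G, GSum.fn_subst H, Set.image_union]
end

theorem finite_preimage_succ {S : Set ℕ} (h : S.Finite) : {k | k + 1 ∈ S}.Finite :=
  h.preimage (Set.injOn_of_injective (add_left_injective 1))

mutual
theorem Proc.finite_fn : ∀ P : Proc, P.fn.Finite
  | .ofSum G => GSum.finite_fn G
  | .rep G => GSum.finite_fn G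
  | .par P Q => (Proc.finite_fn P).union (Proc.finite_fn Q)
  | .res P => finite_preimage_succ (Proc.finite_fn P)
theorem GSum.finite_fn : ∀ G : GSum, G.fn.Finite
  | .nil => Set.finite_empty
  | .out a b P => (Set.toFinite {a, b}).union (Proc.finite_fn P)
  | .inp a P => (Set.finite_singleton a).union (finite_preimage_succ (Proc.finite_fn P))
  | .tau P => Proc.finite_fn P
  | .sum G H => (GSum.finite_fn G).union (GSum.finite_fn H)
end

/-- The name `c` matters only for the second clause of aliased communication, where the extruded
name must differ from the input subject; elsewhere the idle value `0` is passed. -/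
theorem exists_fresh (P Q : Proc) (c : ℕ) : ∃ b, b ∉ P.fn ∧ b ∉ Q.fn ∧ b ≠ c := by
  obtain ⟨b, hb⟩ := ((P.finite_fn.union Q.finite_fn).union (Set.finite_singleton c)).exists_notMem
  simp only [Set.mem_union, Set.mem_singleton_iff, not_or] at hb
  exact ⟨b, hb.1.1, hb.1.2, hb.2⟩

/-- A substitution that replaces the body's bound name by a fresh name factors the action of
`f` on the body. -/
theorem Proc.subst_inst {N : Proc} {b : ℕ} (hb : b + 1 ∉ N.fn) {f g : ℕ → ℕ} (h0 : g b = f 0)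
    (h : ∀ k, k ≠ b → g k = f (k + 1)) : (N.inst b).subst g = N.subst f := by
  rw [Proc.inst_eq, Proc.subst_subst]
  refine N.subst_congr fun x hx => ?_
  cases x with
  | zero => simpa using h0
  | succ k =>
    refine h k ?_
    rintro rfl
    exact hb hx

theorem Proc.close_inst {N : Proc} {b : ℕ} (hb : b + 1 ∉ N.fn) : (N.inst b).close b = N := by
  rw [Proc.close_eq, Proc.subst_inst hb (f := id) (by simp [closeFun])
    (by simp +contextual [closeFun])]
  exact N.subst_id

theorem Proc.nu_inst {N : Proc} {b : ℕ} (hb : b + 1 ∉ N.fn) : Proc.nu b (N.inst b) = .res N := by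
  rw [Proc.nu, Proc.close_inst hb]

@[simp] theorem Proc.par_inst (P Q : Proc) (c : ℕ) :
    (Proc.par P Q).inst c = .par (P.inst c) (Q.inst c) := rfl

theorem Proc.inst_subst (N : Proc) (c : ℕ) (σ : ℕ → ℕ) :
    (N.inst c).subst σ = (N.subst (lift σ)).inst (σ c) := by
  simp only [Proc.inst_eq, Proc.subst_subst]
  congr 1
  funext x
  cases x <;> rfl

@[simp] theorem Proc.succ_inst (P : Proc) (c : ℕ) : (P.subst Nat.succ).inst c = P := by
  rw [Proc.inst_eq, Proc.subst_subst]
  exact P.subst_id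

/-- This matches the exchange of binders in `Step.res` with reception under a restriction, where the
received name `c` is called `c + 1`. -/
theorem Proc.res_swap_inst (N : Proc) (c : ℕ) :
    (Proc.res (N.subst swap)).inst c = .res (N.inst (c + 1)) := by
  simp only [Proc.inst_eq, Proc.subst, Proc.subst_subst]
  congr 2
  funext x
  rcases x with _ | _ | x <;> rfl

/-! ### A transition system without names for bound names -/

/-- Labels of the transition system in which the residual of a bound output or of an input is
the body of a binder. -/
inductive Lab : Type
  | out (a b : ℕ) : Lab
  | bout (a : ℕ) : Lab
  | inp (a : ℕ) : Lab
  | tau : Lab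

namespace Lab

/-- Substitution in a label. -/
def subst (σ : ℕ → ℕ) : Lab → Lab
  | out a b => out (σ a) (σ b)
  | bout a => bout (σ a)
  | inp a => inp (σ a)
  | tau => tau

/-- The embedding of names in the scope of the binder of the label, if any. -/
def wk : Lab → ℕ → ℕ
  | bout _ | inp _ => Nat.succ
  | _ => id

/-- The exchange of the binder of the label, if any, and of the next one. -/
def exch : Lab → ℕ → ℕ
  | bout _ | inp _ => swap
  | _ => id

/-- The action of a substitution in the scope of the binder of the label, if any. -/
def ext : Lab → (ℕ → ℕ) → ℕ → ℕ
  | bout _, σ | inp _, σ => lift σ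
  | _, σ => σ

/-- Free names of a label. -/
def fn : Lab → Set ℕ
  | out a b => {a, b}
  | bout a | inp a => {a}
  | tau => ∅

end Lab

/-- Transitions with residuals that are bodies of binders. -/
inductive Step : Proc → Lab → Proc → Prop
  | inp (a : ℕ) (P : Proc) : Step (.ofSum (.inp a P)) (.inp a) P
  | out (a b : ℕ) (P : Proc) : Step (.ofSum (.out a b P)) (.out a b) P
  | tau (P : Proc) : Step (.ofSum (.tau P)) .tau P
  | sumL {G : GSum} {μ : Lab} {P' : Proc} (H : GSum) :
      Step (.ofSum G) μ P' → Step (.ofSum (.sum G H)) μ P'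
  | sumR {H : GSum} {μ : Lab} {P' : Proc} (G : GSum) :
      Step (.ofSum H) μ P' → Step (.ofSum (.sum G H)) μ P'
  | rep {G : GSum} {μ : Lab} {P' : Proc} :
      Step (.par (.rep G) (.ofSum G)) μ P' → Step (.rep G) μ P'
  -- In `P'` the binder of the label is innermost and the restriction comes next; in the conclusion
  -- the restriction is innermost, whence the exchange.
  | res {P : Proc} {μ : Lab} {P' : Proc} :
      Step P (μ.subst Nat.succ) P' → Step (.res P) μ (.res (P'.subst μ.exch))
  -- The restriction itself turns into the binder of the label, so the body is unchanged.
  | opn {P : Proc} {a : ℕ} {P' : Proc} :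
      Step P (.out (a + 1) 0) P' → Step (.res P) (.bout a) P'
  | parL {P : Proc} {μ : Lab} {P' : Proc} (Q : Proc) :
      Step P μ P' → Step (.par P Q) μ (.par P' (Q.subst μ.wk))
  | parR {Q : Proc} {μ : Lab} {Q' : Proc} (P : Proc) :
      Step Q μ Q' → Step (.par P Q) μ (.par (P.subst μ.wk) Q')
  | commL {P Q : Proc} {a b : ℕ} {N Q' : Proc} :
      Step P (.inp a) N → Step Q (.out a b) Q' → Step (.par P Q) .tau (.par (N.inst b) Q')
  | commR {P Q : Proc} {a b : ℕ} {P' N : Proc} :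
      Step P (.out a b) P' → Step Q (.inp a) N → Step (.par P Q) .tau (.par P' (N.inst b))
  | closeL {P Q : Proc} {a : ℕ} {N M : Proc} :
      Step P (.inp a) N → Step Q (.bout a) M → Step (.par P Q) .tau (.res (.par N M))
  | closeR {P Q : Proc} {a : ℕ} {N M : Proc} :
      Step P (.bout a) N → Step Q (.inp a) M → Step (.par P Q) .tau (.res (.par N M))

namespace Lab

/-- The names that may be free in the residual of a transition with the given label, of a process
with free names in `S`. -/
def scope : Lab → Set ℕ → Set ℕ
  | bout _, S | inp _, S => {x | ∀ k, x = k + 1 → k ∈ S}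
  | _, S => S

theorem wk_mem_scope (μ : Lab) {S : Set ℕ} {x : ℕ} (hx : x ∈ S) : μ.wk x ∈ μ.scope S := by
  cases μ <;> simpa [wk, scope] using hx

theorem scope_mono (μ : Lab) {S T : Set ℕ} (h : S ⊆ T) : μ.scope S ⊆ μ.scope T := by
  cases μ
  case out | tau => exact h
  all_goals exact fun x hx k hk => h (hx k hk)

theorem subst_succ_injective : Function.Injective (subst Nat.succ) := by
  intro μ ν h
  cases μ <;> cases ν <;> simp_all [subst]

@[simp] theorem wk_subst (μ : Lab) (σ : ℕ → ℕ) : (μ.subst σ).wk = μ.wk := by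
  cases μ <;> rfl

@[simp] theorem exch_subst (μ : Lab) (σ : ℕ → ℕ) : (μ.subst σ).exch = μ.exch := by
  cases μ <;> rfl

@[simp] theorem ext_subst (μ : Lab) (σ τ : ℕ → ℕ) : (μ.subst σ).ext τ = μ.ext τ := by
  cases μ <;> rfl

theorem ext_wk (μ : Lab) (σ : ℕ → ℕ) : μ.ext σ ∘ μ.wk = μ.wk ∘ σ := by
  cases μ <;> rfl

theorem lift_ext_exch (μ : Lab) (σ : ℕ → ℕ) :
    lift (μ.ext σ) ∘ μ.exch = μ.exch ∘ μ.ext (lift σ) := by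
  cases μ <;> try rfl
  all_goals
    funext x
    rcases x with _ | _ | x <;> rfl

end Lab

theorem Proc.fn_inst_subset (N : Proc) (c : ℕ) : (N.inst c).fn ⊆ {c} ∪ {k | k + 1 ∈ N.fn} := by
  rw [Proc.inst_eq, Proc.fn_subst]
  rintro _ ⟨x, hx, rfl⟩
  cases x with
  | zero => exact Or.inl rfl
  | succ k => exact Or.inr hx

theorem Step.fn_label {P : Proc} {μ : Lab} {P' : Proc} (h : Step P μ P') : μ.fn ⊆ P.fn := by
  induction h with
  | inp a P => exact Set.subset_union_left
  | out a b P => exact Set.subset_union_left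
  | sumL H _ ih => exact ih.trans Set.subset_union_left
  | sumR H _ ih => exact ih.trans Set.subset_union_right
  | parL Q _ ih => exact ih.trans Set.subset_union_left
  | parR Q _ ih => exact ih.trans Set.subset_union_right
  | rep _ ih => simpa [Proc.fn] using ih
  | @res P μ P' _ ih =>
    intro x hx
    apply ih
    cases μ <;> simp_all [Lab.fn, Lab.subst]
  | opn _ ih =>
    rintro x rfl
    exact ih (Or.inl rfl)
  | tau => exact Set.empty_subset _
  | commL => exact Set.empty_subset _
  | commR => exact Set.empty_subset _
  | closeL => exact Set.empty_subset _
  | closeR => exact Set.empty_subset _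

theorem Step.fn_residual {P : Proc} {μ : Lab} {P' : Proc} (h : Step P μ P') :
    P'.fn ⊆ μ.scope P.fn := by
  induction h with
  | inp a P =>
    rintro x hx k rfl
    exact Or.inr hx
  | out a b P => exact Set.subset_union_right
  | tau P => exact subset_rfl
  | sumL H _ ih => exact ih.trans (Lab.scope_mono _ Set.subset_union_left)
  | sumR H _ ih => exact ih.trans (Lab.scope_mono _ Set.subset_union_right)
  | rep _ ih => simpa [Proc.fn] using ih
  | parL Q _ ih =>
    refine Set.union_subset (ih.trans (Lab.scope_mono _ Set.subset_union_left)) ?_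
    rw [Proc.fn_subst]
    rintro _ ⟨x, hx, rfl⟩
    exact Lab.wk_mem_scope _ (Or.inr hx)
  | parR Q _ ih =>
    refine Set.union_subset ?_ (ih.trans (Lab.scope_mono _ Set.subset_union_right))
    rw [Proc.fn_subst]
    rintro _ ⟨x, hx, rfl⟩
    exact Lab.wk_mem_scope _ (Or.inl hx)
  | @res P μ P' _ ih =>
    intro x hx
    simp only [Proc.fn, Proc.fn_subst, Set.mem_ofPred_eq] at hx
    obtain ⟨y, hy, hyx⟩ := hx
    have hy := ih hy
    cases μ
    case out | tau =>
      subst hyx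
      exact hy
    all_goals
      rintro k rfl
      rcases y with _ | _ | y <;> simp [Lab.exch] at hyx
      subst hyx
      exact hy _ rfl
  | opn _ ih =>
    rintro x hx k rfl
    exact ih hx
  | @commL P Q a b N Q' h₁ h₂ ih₁ ih₂ =>
    refine Set.union_subset ((N.fn_inst_subset b).trans ?_) (ih₂.trans Set.subset_union_right)
    rintro x (rfl | hx)
    · exact Or.inr (h₂.fn_label (Or.inr rfl))
    · exact Or.inl (ih₁ hx x rfl)
  | @commR P Q a b P' N h₁ h₂ ih₁ ih₂ =>
    refine Set.union_subset (ih₁.trans Set.subset_union_left) ((N.fn_inst_subset b).trans ?_)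
    rintro x (rfl | hx)
    · exact Or.inl (h₁.fn_label (Or.inr rfl))
    · exact Or.inr (ih₂ hx x rfl)
  | closeL _ _ ih₁ ih₂ =>
    rintro x (hx | hx)
    · exact Or.inl (ih₁ hx x rfl)
    · exact Or.inr (ih₂ hx x rfl)
  | closeR _ _ ih₁ ih₂ =>
    rintro x (hx | hx)
    · exact Or.inl (ih₁ hx x rfl)
    · exact Or.inr (ih₂ hx x rfl)

theorem Step.notMem_fn_bout {P : Proc} {a b : ℕ} {N : Proc} (h : Step P (.bout a) N)
    (hb : b ∉ P.fn) : b + 1 ∉ N.fn := fun hN => hb (h.fn_residual hN b rfl)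

theorem Step.notMem_fn_inp {P : Proc} {a b : ℕ} {N : Proc} (h : Step P (.inp a) N)
    (hb : b ∉ P.fn) : b + 1 ∉ N.fn := fun hN => hb (h.fn_residual hN b rfl)

/-! ### Transitions and substitutions -/

theorem Proc.subst_wk_ext (P : Proc) (μ : Lab) (σ : ℕ → ℕ) :
    (P.subst μ.wk).subst (μ.ext σ) = (P.subst σ).subst μ.wk := by
  rw [Proc.subst_subst, Proc.subst_subst, Lab.ext_wk]

theorem Proc.subst_exch_ext (P : Proc) (μ : Lab) (σ : ℕ → ℕ) :
    (P.subst μ.exch).subst (lift (μ.ext σ)) = (P.subst (μ.ext (lift σ))).subst μ.exch := by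
  rw [Proc.subst_subst, Proc.subst_subst, Lab.lift_ext_exch]

theorem Lab.subst_succ_lift (μ : Lab) (σ : ℕ → ℕ) :
    (μ.subst Nat.succ).subst (lift σ) = (μ.subst σ).subst Nat.succ := by
  cases μ <;> rfl

/-- The rules only ever require equalities of names, never inequality or freshness, so no
injectivity of `σ` is needed. -/
theorem Step.subst {P : Proc} {μ : Lab} {P' : Proc} (h : Step P μ P') (σ : ℕ → ℕ) :
    Step (P.subst σ) (μ.subst σ) (P'.subst (μ.ext σ)) := by
  induction h generalizing σ with
  | inp a P => exact .inp _ _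
  | out a b P => exact .out _ _ _
  | tau P => exact .tau _
  | sumL H _ ih => exact .sumL _ (ih σ)
  | sumR H _ ih => exact .sumR _ (ih σ)
  | rep _ ih => exact .rep (ih σ)
  | @res P μ P' _ ih =>
    have h := ih (lift σ)
    rw [Lab.subst_succ_lift, Lab.ext_subst] at h
    have h := h.res
    rw [Lab.exch_subst, ← Proc.subst_exch_ext] at h
    exact h
  | opn _ ih => exact .opn (ih (lift σ))
  | @parL P μ P' Q _ ih =>
    have h := Step.parL (Q.subst σ) (ih σ)
    rw [Lab.wk_subst, ← Proc.subst_wk_ext] at h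
    exact h
  | @parR Q μ Q' P _ ih =>
    have h := Step.parR (P.subst σ) (ih σ)
    rw [Lab.wk_subst, ← Proc.subst_wk_ext] at h
    exact h
  | commL _ _ ih₁ ih₂ =>
    have h := Step.commL (ih₁ σ) (ih₂ σ)
    rw [Lab.ext, ← Proc.inst_subst] at h
    exact h
  | commR _ _ ih₁ ih₂ =>
    have h := Step.commR (ih₁ σ) (ih₂ σ)
    rw [Lab.ext.eq_def (Lab.inp _), ← Proc.inst_subst] at h
    exact h
  | closeL _ _ ih₁ ih₂ => exact .closeL (ih₁ σ) (ih₂ σ)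
  | closeR _ _ ih₁ ih₂ => exact .closeR (ih₁ σ) (ih₂ σ)

/-- Early sum rules do not keep a bound name apart from the discarded summand; the freshness claim
of `Act.Spec` survives them only because sums have no bound outputs. -/
theorem Step.not_bout_ofSum {G : GSum} {a : ℕ} {N : Proc} : ¬ Step (.ofSum G) (.bout a) N := by
  intro h
  generalize hZ : Proc.ofSum G = Z at h
  generalize hμ : Lab.bout a = μ at h
  induction h generalizing G with
  | sumL _ _ ih | sumR _ _ ih => exact ih rfl hμ
  | _ => simp_all

/-! ### The two transition systems -/

/-- The transitions of the early transition system in terms of `Step`. -/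
def Act.Spec (P : Proc) : Act → Proc → Prop
  | .out a b, P' => Step P (.out a b) P'
  | .bout a b, P' => b ∉ P.fn ∧ ∃ N, Step P (.bout a) N ∧ P' = N.inst b
  | .inp a c, P' => ∃ N, Step P (.inp a) N ∧ P' = N.inst c
  | .tau, P' => Step P .tau P'

theorem Trans.spec {P : Proc} {μ : Act} {P' : Proc} (h : Trans P μ P') : μ.Spec P P' := by
  induction h with
  | inp a c P => exact ⟨P, .inp a P, rfl⟩
  | out a b P => exact .out a b P
  | tau P => exact .tau P
  | @sumL G μ P' H h ih =>
    cases μ with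
    | out => exact .sumL H ih
    | tau => exact .sumL H ih
    | inp =>
      obtain ⟨N, hN, rfl⟩ := ih
      exact ⟨N, .sumL H hN, rfl⟩
    | bout =>
      obtain ⟨-, N, hN, -⟩ := ih
      exact (Step.not_bout_ofSum hN).elim
  | @sumR H μ P' G h ih =>
    cases μ with
    | out => exact .sumR G ih
    | tau => exact .sumR G ih
    | inp =>
      obtain ⟨N, hN, rfl⟩ := ih
      exact ⟨N, .sumR G hN, rfl⟩
    | bout =>
      obtain ⟨-, N, hN, -⟩ := ih
      exact (Step.not_bout_ofSum hN).elim
  | @rep G μ P' h ih =>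
    cases μ with
    | out => exact .rep ih
    | tau => exact .rep ih
    | inp =>
      obtain ⟨N, hN, rfl⟩ := ih
      exact ⟨N, .rep hN, rfl⟩
    | bout =>
      obtain ⟨hb, N, hN, rfl⟩ := ih
      exact ⟨fun h => hb (Or.inl h), N, .rep hN, rfl⟩
  | @res P μ P' h ih =>
    cases μ with
    | out => simpa only [Act.Spec, Lab.exch, Proc.subst_id] using Step.res (μ := .out _ _) ih
    | tau => simpa only [Act.Spec, Lab.exch, Proc.subst_id] using Step.res (μ := .tau) ih
    | inp =>
      obtain ⟨N, hN, rfl⟩ := ih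
      exact ⟨_, .res (μ := .inp _) hN, (Proc.res_swap_inst _ _).symm⟩
    | bout =>
      obtain ⟨hb, N, hN, rfl⟩ := ih
      exact ⟨hb, _, .res (μ := .bout _) hN, (Proc.res_swap_inst _ _).symm⟩
  | opn h hb ih => exact ⟨hb, _, .opn ih, rfl⟩
  | @parL P μ P' Q h hd ih =>
    cases μ with
    | out => simpa only [Act.Spec, Lab.wk, Proc.subst_id] using Step.parL Q ih
    | tau => simpa only [Act.Spec, Lab.wk, Proc.subst_id] using Step.parL Q ih
    | inp a c =>
      obtain ⟨N, hN, rfl⟩ := ih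
      refine ⟨_, .parL Q hN, ?_⟩
      rw [Proc.par_inst]
      exact congrArg _ (Q.succ_inst c).symm
    | bout a c =>
      obtain ⟨hb, N, hN, rfl⟩ := ih
      refine ⟨?_, _, .parL Q hN, ?_⟩
      · rintro (h | h)
        · exact hb h
        · exact Set.disjoint_left.1 hd rfl h
      · rw [Proc.par_inst]
        exact congrArg _ (Q.succ_inst c).symm
  | @parR Q μ Q' P h hd ih =>
    cases μ with
    | out => simpa only [Act.Spec, Lab.wk, Proc.subst_id] using Step.parR P ih
    | tau => simpa only [Act.Spec, Lab.wk, Proc.subst_id] using Step.parR P ih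
    | inp a c =>
      obtain ⟨N, hN, rfl⟩ := ih
      refine ⟨_, .parR P hN, ?_⟩
      rw [Proc.par_inst]
      exact congrArg (Proc.par · _) (P.succ_inst c).symm
    | bout a c =>
      obtain ⟨hb, N, hN, rfl⟩ := ih
      refine ⟨?_, _, .parR P hN, ?_⟩
      · rintro (h | h)
        · exact Set.disjoint_left.1 hd rfl h
        · exact hb h
      · rw [Proc.par_inst]
        exact congrArg (Proc.par · _) (P.succ_inst c).symm
  | commL _ _ ih₁ ih₂ =>
    obtain ⟨N, hN, rfl⟩ := ih₁
    exact .commL hN ih₂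
  | commR _ _ ih₁ ih₂ =>
    obtain ⟨N, hN, rfl⟩ := ih₂
    exact .commR ih₁ hN
  | closeL _ _ hb ih₁ ih₂ =>
    obtain ⟨N, hN, rfl⟩ := ih₁
    obtain ⟨hb', M, hM, rfl⟩ := ih₂
    -- Naming the bound name `b` and restricting `b` again restores the bodies, as `b` is fresh for
    -- both components.
    rw [← Proc.par_inst, Proc.nu_inst]
    · exact .closeL hN hM
    · rintro (h | h)
      · exact hN.notMem_fn_inp hb h
      · exact hM.notMem_fn_bout hb' h
  | closeR _ _ hb ih₁ ih₂ => 
    obtain ⟨hb', N, hN, rfl⟩ := ih₁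
    obtain ⟨M, hM, rfl⟩ := ih₂
    rw [← Proc.par_inst, Proc.nu_inst]
    · exact .closeR hN hM
    · rintro (h | h)
      · exact hN.notMem_fn_bout hb' h
      · exact hM.notMem_fn_inp hb h

/-- The transitions of the early transition system that a `Step` stands for. -/
def Lab.Spec (P : Proc) : Lab → Proc → Prop
  | .out a b, P' => Trans P (.out a b) P'
  | .bout a, N => ∀ b, b ∉ P.fn → Trans P (.bout a b) (N.inst b)
  | .inp a, N => ∀ c, Trans P (.inp a c) (N.inst c)
  | .tau, P' => Trans P .tau P'

theorem Step.spec {P : Proc} {μ : Lab} {P' : Proc} (h : Step P μ P') : μ.Spec P P' := by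
  induction h with
  | inp a P => exact fun c => .inp a c P
  | out a b P => exact .out a b P
  | tau P => exact .tau P
  | @sumL G μ P' H h ih =>
    cases μ with
    | out | tau => exact .sumL H ih
    | inp => exact fun c => .sumL H (ih c)
    | bout => exact (Step.not_bout_ofSum h).elim
  | @sumR H μ P' G h ih =>
    cases μ with
    | out | tau => exact .sumR G ih
    | inp => exact fun c => .sumR G (ih c)
    | bout => exact (Step.not_bout_ofSum h).elim
  | @rep G μ P' h ih =>
    cases μ with
    | out | tau => exact .rep ih
    | inp => exact fun c => .rep (ih c)
    | bout => exact fun b hb => .rep (ih b fun h => hb (or_self_iff.1 h))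
  | @res P μ P' h ih =>
    cases μ with
    | out =>
      have h := Trans.res (μ := .out _ _) ih
      simpa only [Lab.Spec, Lab.exch, Proc.subst_id] using h
    | tau =>
      have h := Trans.res (μ := .tau) ih
      simpa only [Lab.Spec, Lab.exch, Proc.subst_id] using h
    | inp =>
      intro c
      have h := Trans.res (μ := .inp _ _) (ih (c + 1))
      rwa [← Proc.res_swap_inst] at h
    | bout =>
      intro c hc
      have h := Trans.res (μ := .bout _ _) (ih (c + 1) hc)
      rwa [← Proc.res_swap_inst] at h
  | opn _ ih => exact fun b hb => .opn ih hb
  | @parL P μ P' Q h ih =>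
    cases μ with
    | out =>
      have h := Trans.parL Q ih (Set.empty_disjoint _)
      simpa only [Lab.Spec, Lab.wk, Proc.subst_id] using h
    | tau =>
      have h := Trans.parL Q ih (Set.empty_disjoint _)
      simpa only [Lab.Spec, Lab.wk, Proc.subst_id] using h
    | inp =>
      intro c
      have h := Trans.parL Q (ih c) (Set.empty_disjoint _)
      rwa [← Q.succ_inst c, ← Proc.par_inst, Q.succ_inst c] at h
    | bout =>
      intro c hc
      have h := Trans.parL Q (ih c fun h => hc (Or.inl h))
        (Set.disjoint_singleton_left.2 fun h => hc (Or.inr h))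
      rwa [← Q.succ_inst c, ← Proc.par_inst, Q.succ_inst c] at h
  | @parR Q μ Q' P h ih =>
    cases μ with
    | out =>
      have h := Trans.parR P ih (Set.empty_disjoint _)
      simpa only [Lab.Spec, Lab.wk, Proc.subst_id] using h
    | tau =>
      have h := Trans.parR P ih (Set.empty_disjoint _)
      simpa only [Lab.Spec, Lab.wk, Proc.subst_id] using h
    | inp =>
      intro c
      have h := Trans.parR P (ih c) (Set.empty_disjoint _)
      rwa [← P.succ_inst c, ← Proc.par_inst, P.succ_inst c] at h
    | bout =>
      intro c hc
      have h := Trans.parR P (ih c fun h => hc (Or.inr h))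
        (Set.disjoint_singleton_left.2 fun h => hc (Or.inl h))
      rwa [← P.succ_inst c, ← Proc.par_inst, P.succ_inst c] at h
  | commL _ _ ih₁ ih₂ => exact .commL (ih₁ _) ih₂
  | commR _ _ ih₁ ih₂ => exact .commR ih₁ (ih₂ _)
  | @closeL P Q a N M h₁ h₂ ih₁ ih₂ =>
    obtain ⟨b, hP, hQ, -⟩ := exists_fresh P Q 0
    have h := Trans.closeL (ih₁ b) (ih₂ b hQ) hP
    rwa [← Proc.par_inst, Proc.nu_inst] at h
    rintro (h | h)
    · exact h₁.notMem_fn_inp hP h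
    · exact h₂.notMem_fn_bout hQ h
  | @closeR P Q a N M h₁ h₂ ih₁ ih₂ =>
    obtain ⟨b, hP, hQ, -⟩ := exists_fresh P Q 0
    have h := Trans.closeR (ih₁ b hP) (ih₂ b) hQ
    rwa [← Proc.par_inst, Proc.nu_inst] at h
    rintro (h | h)
    · exact h₁.notMem_fn_bout hP h
    · exact h₂.notMem_fn_inp hQ h

/-! ### Transitions of substitution instances -/

theorem injOn_lift {σ : ℕ → ℕ} {S : Set ℕ} (h : Set.InjOn σ {k | k + 1 ∈ S}) :
    Set.InjOn (lift σ) S := by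
  intro x hx y hy hxy
  cases x <;> cases y <;> simp_all
  exact h hx hy hxy

theorem lift_eq_succ {σ : ℕ → ℕ} {x y : ℕ} (h : lift σ x = y + 1) : ∃ z, x = z + 1 ∧ σ z = y := by
  cases x with
  | zero => simp at h
  | succ z => exact ⟨z, rfl, by simpa using h⟩

theorem lift_eq_zero {σ : ℕ → ℕ} {x : ℕ} (h : lift σ x = 0) : x = 0 := by
  cases x with
  | zero => rfl
  | succ z => simp at h

theorem Lab.eq_subst_succ_of_subst_lift {μ ν : Lab} {σ : ℕ → ℕ}
    (h : μ.subst (lift σ) = ν.subst Nat.succ) : ∃ κ : Lab, μ = κ.subst Nat.succ ∧ κ.subst σ = ν := by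
  cases μ <;> cases ν <;> simp only [subst, Lab.out.injEq, Lab.bout.injEq, Lab.inp.injEq,
    reduceCtorEq] at h
  · obtain ⟨a, rfl, ha⟩ := lift_eq_succ h.1
    obtain ⟨b, rfl, hb⟩ := lift_eq_succ h.2
    exact ⟨.out a b, rfl, by simp [subst, ha, hb]⟩
  · obtain ⟨a, rfl, ha⟩ := lift_eq_succ h
    exact ⟨.bout a, rfl, by simp [subst, ha]⟩
  · obtain ⟨a, rfl, ha⟩ := lift_eq_succ h
    exact ⟨.inp a, rfl, by simp [subst, ha]⟩
  · exact ⟨.tau, rfl, rfl⟩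

/-- Transitions of `Pσ` come from transitions of `P`, except for communications that `σ`
makes possible. -/
theorem Step.of_subst {P : Proc} {σ : ℕ → ℕ} {ν : Lab} {X : Proc} (h : Step (P.subst σ) ν X)
    (hσ : ν = .tau → Set.InjOn σ P.fn) :
    ∃ μ P', Step P μ P' ∧ μ.subst σ = ν ∧ X = P'.subst (μ.ext σ) := by
  generalize hZ : P.subst σ = Z at h
  induction h generalizing P σ with
  | inp a A =>
    rcases P with (_ | _ | _ | _ | _) | _ | _ | _ <;> simp [Proc.subst, GSum.subst] at hZ
    obtain ⟨rfl, rfl⟩ := hZ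
    exact ⟨_, _, .inp _ _, rfl, rfl⟩
  | out a b A =>
    rcases P with (_ | _ | _ | _ | _) | _ | _ | _ <;> simp [Proc.subst, GSum.subst] at hZ
    obtain ⟨rfl, rfl, rfl⟩ := hZ
    exact ⟨_, _, .out _ _ _, rfl, rfl⟩
  | tau A =>
    rcases P with (_ | _ | _ | _ | _) | _ | _ | _ <;> simp [Proc.subst, GSum.subst] at hZ
    subst hZ
    exact ⟨_, _, .tau _, rfl, rfl⟩
  | sumL H _ ih =>
    rcases P with (_ | _ | _ | _ | _) | _ | _ | _ <;> simp [Proc.subst, GSum.subst] at hZ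
    obtain ⟨hG, rfl⟩ := hZ
    obtain ⟨μ, P', h, hμ, hX⟩ := ih (P := .ofSum _)
      (fun e => (hσ e).mono Set.subset_union_left) (congrArg _ hG)
    exact ⟨μ, P', .sumL _ h, hμ, hX⟩
  | sumR H _ ih =>
    rcases P with (_ | _ | _ | _ | _) | _ | _ | _ <;> simp [Proc.subst, GSum.subst] at hZ
    obtain ⟨rfl, hG⟩ := hZ
    obtain ⟨μ, P', h, hμ, hX⟩ := ih (P := .ofSum _)
      (fun e => (hσ e).mono Set.subset_union_right) (congrArg _ hG)
    exact ⟨μ, P', .sumR _ h, hμ, hX⟩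
  | rep _ ih =>
    rcases P with _ | G | _ | _ <;> simp [Proc.subst] at hZ
    subst hZ
    obtain ⟨μ, P', h, hμ, hX⟩ := ih (P := .par (.rep G) (.ofSum G))
      (fun e => by simpa [Proc.fn] using hσ e) rfl
    exact ⟨μ, P', .rep h, hμ, hX⟩
  | @res A ν X _ ih =>
    rcases P with _ | _ | _ | P <;> simp [Proc.subst] at hZ
    subst hZ
    obtain ⟨μ, P', h, hμ, rfl⟩ := ih (fun e => by
      refine injOn_lift (hσ ?_)
      cases ν <;> simp_all [Lab.subst]) rfl
    obtain ⟨μ, rfl, rfl⟩ := Lab.eq_subst_succ_of_subst_lift hμ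
    refine ⟨μ, _, .res h, rfl, ?_⟩
    rw [Lab.ext_subst, Lab.exch_subst, Proc.subst, Proc.subst_exch_ext]
  | opn _ ih =>
    rcases P with _ | _ | _ | P <;> simp [Proc.subst] at hZ
    subst hZ
    obtain ⟨μ, P', h, hμ, rfl⟩ := ih (by simp) rfl
    cases μ <;> simp only [Lab.subst, Lab.out.injEq, reduceCtorEq] at hμ
    obtain ⟨a, rfl, rfl⟩ := lift_eq_succ hμ.1
    obtain rfl := lift_eq_zero hμ.2
    exact ⟨_, _, .opn h, rfl, rfl⟩
  | parL Q _ ih =>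
    rcases P with _ | _ | ⟨A, B⟩ | _ <;> simp [Proc.subst] at hZ
    obtain ⟨rfl, rfl⟩ := hZ
    obtain ⟨μ, P', h, rfl, rfl⟩ := ih (fun e => (hσ e).mono Set.subset_union_left) rfl
    refine ⟨μ, _, .parL _ h, rfl, ?_⟩
    rw [Lab.wk_subst, Proc.subst, Proc.subst_wk_ext]
  | parR Q _ ih =>
    rcases P with _ | _ | ⟨A, B⟩ | _ <;> simp [Proc.subst] at hZ
    obtain ⟨rfl, rfl⟩ := hZ
    obtain ⟨μ, P', h, rfl, rfl⟩ := ih (fun e => (hσ e).mono Set.subset_union_right) rfl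
    refine ⟨μ, _, .parR _ h, rfl, ?_⟩
    rw [Lab.wk_subst, Proc.subst, Proc.subst_wk_ext]
  | commL _ _ ih₁ ih₂ =>
    rcases P with _ | _ | ⟨A, B⟩ | _ <;> simp [Proc.subst] at hZ
    obtain ⟨rfl, rfl⟩ := hZ
    obtain ⟨μ, N, h₁, hμ, rfl⟩ := ih₁ (by simp) rfl
    obtain ⟨ν, Q', h₂, hν, rfl⟩ := ih₂ (by simp) rfl
    cases μ <;> simp only [Lab.subst, Lab.inp.injEq, reduceCtorEq] at hμ
    cases ν <;> simp only [Lab.subst, Lab.out.injEq, reduceCtorEq] at hν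
    obtain ⟨hν, rfl⟩ := hν
    -- Injectivity matters only for communications: both subjects are free in the process and have
    -- the same image, so they were already equal.
    obtain rfl := hσ rfl (Or.inl (h₁.fn_label rfl)) (Or.inr (h₂.fn_label (Or.inl rfl)))
      (hμ.trans hν.symm)
    refine ⟨.tau, _, .commL h₁ h₂, rfl, ?_⟩
    simp only [Lab.ext, Proc.subst, Proc.inst_subst]
  | commR _ _ ih₁ ih₂ =>
    rcases P with _ | _ | ⟨A, B⟩ | _ <;> simp [Proc.subst] at hZ
    obtain ⟨rfl, rfl⟩ := hZ
    obtain ⟨μ, N, h₁, hμ, rfl⟩ := ih₁ (by simp) rfl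
    obtain ⟨ν, Q', h₂, hν, rfl⟩ := ih₂ (by simp) rfl
    cases μ <;> simp only [Lab.subst, Lab.out.injEq, reduceCtorEq] at hμ
    cases ν <;> simp only [Lab.subst, Lab.inp.injEq, reduceCtorEq] at hν
    obtain ⟨hμ, rfl⟩ := hμ
    obtain rfl := hσ rfl (Or.inl (h₁.fn_label (Or.inl rfl))) (Or.inr (h₂.fn_label rfl))
      (hμ.trans hν.symm)
    refine ⟨.tau, _, .commR h₁ h₂, rfl, ?_⟩
    simp only [Lab.ext, Proc.subst, Proc.inst_subst]
  | closeL _ _ ih₁ ih₂ =>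
    rcases P with _ | _ | ⟨A, B⟩ | _ <;> simp [Proc.subst] at hZ
    obtain ⟨rfl, rfl⟩ := hZ
    obtain ⟨μ, N, h₁, hμ, rfl⟩ := ih₁ (by simp) rfl
    obtain ⟨ν, Q', h₂, hν, rfl⟩ := ih₂ (by simp) rfl
    cases μ <;> simp only [Lab.subst, Lab.inp.injEq, reduceCtorEq] at hμ
    cases ν <;> simp only [Lab.subst, Lab.bout.injEq, reduceCtorEq] at hν
    obtain rfl := hσ rfl (Or.inl (h₁.fn_label rfl)) (Or.inr (h₂.fn_label rfl))
      (hμ.trans hν.symm)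
    exact ⟨.tau, _, .closeL h₁ h₂, rfl, rfl⟩
  | closeR _ _ ih₁ ih₂ =>
    rcases P with _ | _ | ⟨A, B⟩ | _ <;> simp [Proc.subst] at hZ
    obtain ⟨rfl, rfl⟩ := hZ
    obtain ⟨μ, N, h₁, hμ, rfl⟩ := ih₁ (by simp) rfl
    obtain ⟨ν, Q', h₂, hν, rfl⟩ := ih₂ (by simp) rfl
    cases μ <;> simp only [Lab.subst, Lab.bout.injEq, reduceCtorEq] at hμ
    cases ν <;> simp only [Lab.subst, Lab.inp.injEq, reduceCtorEq] at hν
    obtain rfl := hσ rfl (Or.inl (h₁.fn_label rfl)) (Or.inr (h₂.fn_label rfl))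
      (hμ.trans hν.symm)
    exact ⟨.tau, _, .closeR h₁ h₂, rfl, rfl⟩

/-! ### The contextual closure of a relation -/

theorem refl_mem_bisimilarity (P : Proc) : (P, P) ∈ bisimilarity := by
  refine ⟨{X | X.1 = X.2}, ?_, rfl⟩
  rintro ⟨P, Q⟩ h
  obtain rfl : P = Q := h
  exact ⟨fun μ P' h _ => ⟨P', h, rfl⟩, fun μ P' h _ => ⟨P', h, rfl⟩⟩

theorem s_mono {R S : Rel} (h : R ⊆ S) : s R ⊆ s S := fun _ hX μ P' hP hd =>
  let ⟨Q', hQ, hR⟩ := hX μ P' hP hd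
  ⟨Q', hQ, h hR⟩

theorem b_mono {R S : Rel} (h : R ⊆ S) : b R ⊆ b S := fun _ hX =>
  ⟨s_mono h hX.1, s_mono (R := conv R) (S := conv S) (fun _ hY => h hY) hX.2⟩

theorem bisimilarity_subset_b : bisimilarity ⊆ b bisimilarity := by
  rintro X ⟨R, hR, hX⟩
  exact b_mono (Set.subset_sUnion_of_mem hR) (hR hX)

/-- The closure of `R` and bisimilarity under contexts, injective renamings and, for processes
in `C`, under input prefixes and all substitutions. -/
inductive Ctx (C : Set Proc) (R : Rel) : Proc → Proc → Prop
  | base {P Q : Proc} : (P, Q) ∈ R → Ctx C R P Q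
  | bisim {P Q : Proc} : (P, Q) ∈ bisimilarity → Ctx C R P Q
  | symm {P Q : Proc} : Ctx C R P Q → Ctx C R Q P
  | trans {P Q S : Proc} : Ctx C R P Q → Ctx C R Q S → Ctx C R P S
  -- Passing under binders renames processes that need not lie in `C`. Injectivity on the free names
  -- ensures that no new communication appears.
  | rename {P Q : Proc} {σ : ℕ → ℕ} :
      Ctx C R P Q → Set.InjOn σ (P.fn ∪ Q.fn) → Ctx C R (P.subst σ) (Q.subst σ)
  | sub {P Q : Proc} (σ : ℕ → ℕ) :
      Ctx C R P Q → P ∈ C → Q ∈ C → Ctx C R (P.subst σ) (Q.subst σ)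
  | res {P Q : Proc} : Ctx C R P Q → Ctx C R (.res P) (.res Q)
  | par {P Q P' Q' : Proc} : Ctx C R P Q → Ctx C R P' Q' → Ctx C R (.par P P') (.par Q Q')
  | sum {G₁ G₂ G₁' G₂' : GSum} : Ctx C R (.ofSum G₁) (.ofSum G₁') →
      Ctx C R (.ofSum G₂) (.ofSum G₂') → Ctx C R (.ofSum (.sum G₁ G₂)) (.ofSum (.sum G₁' G₂'))
  | rep {G G' : GSum} : Ctx C R (.ofSum G) (.ofSum G') → Ctx C R (.rep G) (.rep G')
  | tau {P Q : Proc} : Ctx C R P Q → Ctx C R (.ofSum (.tau P)) (.ofSum (.tau Q))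
  | out {P Q : Proc} (a b : ℕ) :
      Ctx C R P Q → Ctx C R (.ofSum (.out a b P)) (.ofSum (.out a b Q))
  | input {P Q : Proc} (a b : ℕ) : Ctx C R P Q → P ∈ C → Q ∈ C →
      Ctx C R (.ofSum (GSum.input a b P)) (.ofSum (GSum.input a b Q))

variable {C : Set Proc} {R : Rel}

theorem Ctx.refl (P : Proc) : Ctx C R P P := .bisim (refl_mem_bisimilarity P)

theorem Ctx.rename_of_injective {P Q : Proc} {σ : ℕ → ℕ} (h : Ctx C R P Q)
    (hσ : Function.Injective σ) : Ctx C R (P.subst σ) (Q.subst σ) :=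
  h.rename hσ.injOn

theorem Ctx.wk {P Q : Proc} (h : Ctx C R P Q) (μ : Lab) :
    Ctx C R (P.subst μ.wk) (Q.subst μ.wk) := by
  refine h.rename_of_injective ?_
  cases μ
  case out | tau => exact Function.injective_id
  all_goals exact Nat.succ_injective

/-- Rebinding `b` is an injective renaming and undoes the instantiation, so membership in `C` is not
needed. -/
theorem Ctx.of_inst {N M : Proc} {b : ℕ} (h : Ctx C R (N.inst b) (M.inst b))
    (hN : b + 1 ∉ N.fn) (hM : b + 1 ∉ M.fn) : Ctx C R N M := by
  have h := h.rename_of_injective (closeFun_injective b)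
  rwa [← Proc.close_eq, ← Proc.close_eq, Proc.close_inst hN, Proc.close_inst hM] at h

theorem injOn_instFun {b : ℕ} {S : Set ℕ} (hb : b + 1 ∉ S) : Set.InjOn (instFun b) S := by
  intro x hx y hy h
  cases x <;> cases y <;> simp_all

theorem Ctx.inst {N M : Proc} {b : ℕ} (h : Ctx C R N M)
    (hN : b + 1 ∉ N.fn) (hM : b + 1 ∉ M.fn) : Ctx C R (N.inst b) (M.inst b) := by
  rw [Proc.inst_eq, Proc.inst_eq]
  refine h.rename (injOn_instFun ?_)
  rintro (h | h)
  · exact hN h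
  · exact hM h

/-! ### Answers to transitions -/

/-- `Q` can answer a transition with label `μ` and residual `P'`, up to `U`. -/
def Answer (U : Proc → Proc → Prop) (Q : Proc) : Lab → Proc → Prop
  | .out a b, P' => ∃ Q', Step Q (.out a b) Q' ∧ U P' Q'
  | .bout a, N => ∃ M, Step Q (.bout a) M ∧ U N M
  | .inp a, N => ∀ c, ∃ M, Step Q (.inp a) M ∧ U (N.inst c) (M.inst c)
  | .tau, P' => ∃ Q', Step Q .tau Q' ∧ U P' Q'

/-- `Q` can answer all transitions of `P`, except for the internal ones if `k` is false. -/
def Sim (U : Proc → Proc → Prop) (k : Prop) (P Q : Proc) : Prop :=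
  ∀ μ P', (μ = .tau → k) → Step P μ P' → Answer U Q μ P'

theorem Answer.map {U : Proc → Proc → Prop} {P Q : Proc} {μ : Lab} {X : Proc}
    (h : Answer U P μ X) (hPQ : ∀ Y, Step P μ Y → Step Q μ Y) : Answer U Q μ X := by
  cases μ
  case inp => exact fun c => let ⟨M, hM, hU⟩ := h c; ⟨M, hPQ _ hM, hU⟩
  all_goals exact let ⟨M, hM, hU⟩ := h; ⟨M, hPQ _ hM, hU⟩

/-- An early answer may depend on the received name. The one for a fresh name serves for the whole
body, which is what the close rules need, since there the received name is the extruded one. -/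
theorem Answer.inp_open {Q N : Proc} {a : ℕ} (h : Answer (Ctx C R) Q (.inp a) N) :
    ∃ M, Step Q (.inp a) M ∧ Ctx C R N M := by
  -- Freshness for `.res N` says exactly that `c + 1` is not free in the body `N`.
  obtain ⟨c, hN, hQ, -⟩ := exists_fresh (.res N) Q 0
  obtain ⟨M, hM, hU⟩ := h c
  exact ⟨M, hM, hU.of_inst hN (hM.notMem_fn_inp hQ)⟩

theorem Answer.parL {Q A B P' : Proc} {μ : Lab} (h : Answer (Ctx C R) Q μ P')
    (hAB : Ctx C R A B) : Answer (Ctx C R) (.par Q B) μ (.par P' (A.subst μ.wk)) := by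
  cases μ
  case inp =>
    intro c
    obtain ⟨M, hM, hU⟩ := h c
    refine ⟨_, .parL B hM, ?_⟩
    simp only [Lab.wk, Proc.par_inst, Proc.succ_inst]
    exact hU.par hAB
  all_goals
    obtain ⟨M, hM, hU⟩ := h
    exact ⟨_, .parL B hM, hU.par (hAB.wk _)⟩

theorem Answer.parR {Q A B P' : Proc} {μ : Lab} (h : Answer (Ctx C R) Q μ P')
    (hAB : Ctx C R A B) : Answer (Ctx C R) (.par B Q) μ (.par (A.subst μ.wk) P') := by
  cases μ
  case inp =>
    intro c
    obtain ⟨M, hM, hU⟩ := h c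
    refine ⟨_, .parR B hM, ?_⟩
    simp only [Lab.wk, Proc.par_inst, Proc.succ_inst]
    exact hAB.par hU
  all_goals
    obtain ⟨M, hM, hU⟩ := h
    exact ⟨_, .parR B hM, (hAB.wk _).par hU⟩

theorem Answer.commL {P Q N Q' : Proc} {a b : ℕ} (h₁ : Answer (Ctx C R) P (.inp a) N)
    (h₂ : Answer (Ctx C R) Q (.out a b) Q') :
    Answer (Ctx C R) (.par P Q) .tau (.par (N.inst b) Q') := by
  obtain ⟨M, hM, hU⟩ := h₁ b
  obtain ⟨Q'', hQ, hV⟩ := h₂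
  exact ⟨_, .commL hM hQ, hU.par hV⟩

theorem Answer.commR {P Q P' N : Proc} {a b : ℕ} (h₁ : Answer (Ctx C R) P (.out a b) P')
    (h₂ : Answer (Ctx C R) Q (.inp a) N) :
    Answer (Ctx C R) (.par P Q) .tau (.par P' (N.inst b)) := by
  obtain ⟨P'', hP, hV⟩ := h₁
  obtain ⟨M, hM, hU⟩ := h₂ b
  exact ⟨_, .commR hP hM, hV.par hU⟩

theorem Answer.closeL {P Q N M : Proc} {a : ℕ} (h₁ : Answer (Ctx C R) P (.inp a) N)
    (h₂ : Answer (Ctx C R) Q (.bout a) M) :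
    Answer (Ctx C R) (.par P Q) .tau (.res (.par N M)) := by
  obtain ⟨N', hN, hU⟩ := h₁.inp_open
  obtain ⟨M', hM, hV⟩ := h₂
  exact ⟨_, .closeL hN hM, (hU.par hV).res⟩

theorem Answer.closeR {P Q N M : Proc} {a : ℕ} (h₁ : Answer (Ctx C R) P (.bout a) N)
    (h₂ : Answer (Ctx C R) Q (.inp a) M) :
    Answer (Ctx C R) (.par P Q) .tau (.res (.par N M)) := by
  obtain ⟨N', hN, hU⟩ := h₁
  obtain ⟨M', hM, hV⟩ := h₂.inp_open
  exact ⟨_, .closeR hN hM, (hU.par hV).res⟩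

theorem Sim.par {k : Prop} {P Q P' Q' : Proc} (h : Sim (Ctx C R) k P Q)
    (h' : Sim (Ctx C R) k P' Q') (hU : Ctx C R P Q) (hU' : Ctx C R P' Q') :
    Sim (Ctx C R) k (.par P P') (.par Q Q') := by
  intro μ X hμ hX
  cases hX with
  | parL _ hP => exact (h _ _ hμ hP).parL hU'
  | parR _ hP => exact (h' _ _ hμ hP).parR hU
  | commL h₁ h₂ => exact (h _ _ (by simp) h₁).commL (h' _ _ (by simp) h₂)
  | commR h₁ h₂ => exact (h _ _ (by simp) h₁).commR (h' _ _ (by simp) h₂)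
  | closeL h₁ h₂ => exact (h _ _ (by simp) h₁).closeL (h' _ _ (by simp) h₂)
  | closeR h₁ h₂ => exact (h _ _ (by simp) h₁).closeR (h' _ _ (by simp) h₂)

theorem Sim.rep {k : Prop} {G G' : GSum} (h : Sim (Ctx C R) k (.ofSum G) (.ofSum G'))
    (hU : Ctx C R (.ofSum G) (.ofSum G')) : Sim (Ctx C R) k (.rep G) (.rep G') := by
  -- The derivation alternates between the replication and its unfolding, so both are treated in one
  -- induction on derivations.
  have key : ∀ {Z μ X}, Step Z μ X → (μ = .tau → k) →
      (Z = .rep G → Answer (Ctx C R) (.rep G') μ X) ∧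
      (Z = .par (.rep G) (.ofSum G) →
        Answer (Ctx C R) (.par (.rep G') (.ofSum G')) μ X) := by
    intro Z μ X hX hμ
    induction hX with
    | rep _ ih =>
      refine ⟨fun e => ?_, nofun⟩
      cases e
      exact ((ih hμ).2 rfl).map fun _ => Step.rep
    | parL _ h₁ ih =>
      refine ⟨nofun, fun e => ?_⟩
      cases e
      exact ((ih hμ).1 rfl).parL hU
    | parR _ h₁ ih =>
      refine ⟨nofun, fun e => ?_⟩
      cases e
      exact (h _ _ hμ h₁).parR hU.rep
    | commL h₁ h₂ ih₁ ih₂ =>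
      refine ⟨nofun, fun e => ?_⟩
      cases e
      exact ((ih₁ (by simp)).1 rfl).commL (h _ _ (by simp) h₂)
    | commR h₁ h₂ ih₁ ih₂ =>
      refine ⟨nofun, fun e => ?_⟩
      cases e
      exact ((ih₁ (by simp)).1 rfl).commR (h _ _ (by simp) h₂)
    | closeL h₁ h₂ ih₁ ih₂ =>
      refine ⟨nofun, fun e => ?_⟩
      cases e
      exact ((ih₁ (by simp)).1 rfl).closeL (h _ _ (by simp) h₂)
    | closeR h₁ h₂ ih₁ ih₂ =>
      refine ⟨nofun, fun e => ?_⟩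
      cases e
      exact ((ih₁ (by simp)).1 rfl).closeR (h _ _ (by simp) h₂)
    | _ => exact ⟨nofun, nofun⟩
  exact fun μ X hμ hX => (key hX hμ).1 rfl

theorem Sim.trans {k : Prop} {P Q S : Proc} (h : Sim (Ctx C R) k P Q)
    (h' : Sim (Ctx C R) k Q S) : Sim (Ctx C R) k P S := by
  intro μ X hμ hX
  have hQ := h μ X hμ hX
  cases μ
  case inp =>
    intro c
    obtain ⟨M, hM, hU⟩ := hQ c
    obtain ⟨L, hL, hV⟩ := h' _ _ hμ hM c
    exact ⟨L, hL, hU.trans hV⟩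
  all_goals
    obtain ⟨M, hM, hU⟩ := hQ
    obtain ⟨L, hL, hV⟩ := h' _ _ hμ hM
    exact ⟨L, hL, hU.trans hV⟩

theorem Sim.res {k : Prop} {P Q : Proc} (h : Sim (Ctx C R) k P Q) :
    Sim (Ctx C R) k (.res P) (.res Q) := by
  intro μ X hμ hX
  cases hX with
  | opn hP =>
    obtain ⟨M, hM, hU⟩ := h _ _ (by simp) hP
    exact ⟨M, .opn hM, hU⟩
  | res hP =>
    have hQ := h _ _ (fun e => hμ (by cases μ <;> simp_all [Lab.subst])) hP
    cases μ
    case inp =>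
      intro c
      obtain ⟨M, hM, hU⟩ := hQ (c + 1)
      refine ⟨_, .res hM, ?_⟩
      simp only [Lab.exch, Proc.res_swap_inst]
      exact hU.res
    case bout =>
      obtain ⟨M, hM, hU⟩ := hQ
      exact ⟨_, .res hM, (hU.rename_of_injective swap_injective).res⟩
    all_goals
      obtain ⟨M, hM, hU⟩ := hQ
      exact ⟨_, .res hM, (hU.rename_of_injective Function.injective_id).res⟩

theorem Sim.sum {k : Prop} {G₁ G₂ G₁' G₂' : GSum}
    (h₁ : Sim (Ctx C R) k (.ofSum G₁) (.ofSum G₁'))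
    (h₂ : Sim (Ctx C R) k (.ofSum G₂) (.ofSum G₂')) :
    Sim (Ctx C R) k (.ofSum (.sum G₁ G₂)) (.ofSum (.sum G₁' G₂')) := by
  intro μ X hμ hX
  cases hX with
  | sumL _ h => exact (h₁ _ _ hμ h).map fun _ => Step.sumL _
  | sumR _ h => exact (h₂ _ _ hμ h).map fun _ => Step.sumR _

theorem Proc.subst_update_inst {N : Proc} {b : ℕ} (hb : b + 1 ∉ N.fn) (σ : ℕ → ℕ) (c : ℕ) :
    (N.inst b).subst (Function.update σ b c) = (N.subst (lift σ)).inst c := by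
  rw [Proc.inst_eq c, Proc.subst_subst]
  exact Proc.subst_inst hb (by simp) (by simp +contextual)

theorem Sim.rename {k : Prop} {P Q : Proc} {σ : ℕ → ℕ} (h : Sim (Ctx C R) k P Q)
    (hσ : Set.InjOn σ (P.fn ∪ Q.fn)) : Sim (Ctx C R) k (P.subst σ) (Q.subst σ) := by
  intro ν X hν hX
  obtain ⟨μ, P', hP, rfl, rfl⟩ := hX.of_subst fun _ => hσ.mono Set.subset_union_left
  have hQ := h μ P' (fun e => hν (by rw [e]; rfl)) hP
  cases μ
  case inp a =>
    intro c
    -- If the received name is the image of a free name `x`, receiving `x` before renaming keeps `σ`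
    -- injective on the residuals.
    by_cases hc : ∃ x ∈ P.fn ∪ Q.fn, σ x = c
    · obtain ⟨x, hx, rfl⟩ := hc
      obtain ⟨M, hM, hU⟩ := hQ x
      refine ⟨_, hM.subst σ, ?_⟩
      simp only [Lab.ext, ← Proc.inst_subst]
      refine hU.rename (hσ.mono (Set.union_subset ((P'.fn_inst_subset x).trans ?_)
        ((M.fn_inst_subset x).trans ?_)))
      · rintro y (rfl | hy)
        · exact hx
        · exact Or.inl (hP.fn_residual hy y rfl)
      · rintro y (rfl | hy)
        · exact hx
        · exact Or.inr (hM.fn_residual hy y rfl)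
    -- Otherwise a fresh `x` is received and `σ` is redirected to send `x` to `c`; as `c` is not an
    -- image of a free name, injectivity persists.
    · obtain ⟨x, hxP, hxQ, -⟩ := exists_fresh P Q 0
      obtain ⟨M, hM, hU⟩ := hQ x
      refine ⟨_, hM.subst σ, ?_⟩
      simp only [Lab.ext]
      rw [← Proc.subst_update_inst (hP.notMem_fn_inp hxP),
        ← Proc.subst_update_inst (hM.notMem_fn_inp hxQ)]
      have hsub : (P'.inst x).fn ∪ (M.inst x).fn ⊆ {x} ∪ (P.fn ∪ Q.fn) := by
        refine Set.union_subset ((P'.fn_inst_subset x).trans (Set.union_subset_union_right _ ?_))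
          ((M.fn_inst_subset x).trans (Set.union_subset_union_right _ ?_))
        · exact fun y hy => Or.inl (hP.fn_residual hy y rfl)
        · exact fun y hy => Or.inr (hM.fn_residual hy y rfl)
      refine hU.rename (Set.InjOn.mono hsub ?_)
      rintro y hy z hz hyz
      by_cases hyx : y = x <;> by_cases hzx : z = x
      · rw [hyx, hzx]
      · rcases hz with hz | hz
        · exact absurd hz hzx
        · simp only [hyx, Function.update_self, Function.update_of_ne hzx] at hyz
          exact absurd ⟨z, hz, hyz.symm⟩ hc
      · rcases hy with hy | hy
        · exact absurd hy hyx
        · simp only [hzx, Function.update_self, Function.update_of_ne hyx] at hyz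
          exact absurd ⟨y, hy, hyz⟩ hc
      · rw [Function.update_of_ne hyx, Function.update_of_ne hzx] at hyz
        exact hσ (hy.resolve_left hyx) (hz.resolve_left hzx) hyz
  case bout a =>
    obtain ⟨M, hM, hU⟩ := hQ
    refine ⟨_, hM.subst σ, hU.rename (injOn_lift (hσ.mono ?_))⟩
    rintro y (hy | hy)
    · exact Or.inl (hP.fn_residual hy y rfl)
    · exact Or.inr (hM.fn_residual hy y rfl)
  all_goals
    obtain ⟨M, hM, hU⟩ := hQ
    exact ⟨_, hM.subst σ, hU.rename
      (hσ.mono (Set.union_subset_union hP.fn_residual hM.fn_residual))⟩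

/-- After reception the residuals are substitution instances of `P` and `Q`, in general not
injective ones; hence the membership in `C`. -/
theorem Sim.input {k : Prop} {P Q : Proc} (h : Ctx C R P Q) (hP : P ∈ C) (hQ : Q ∈ C) (a b : ℕ) :
    Sim (Ctx C R) k (.ofSum (GSum.input a b P)) (.ofSum (GSum.input a b Q)) := by
  intro μ X _ hX
  cases hX with
  | inp =>
    intro c
    refine ⟨_, .inp a _, ?_⟩
    simp only [Proc.close_eq, Proc.inst_eq, Proc.subst_subst]
    exact h.sub _ hP hQ

/-- Answers in the early transition system give answers to the transitions `Step`. -/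
theorem Sim.of_mem_s {T : Rel} {P Q : Proc} (h : (P, Q) ∈ s T)
    (hT : ∀ X Y, (X, Y) ∈ T → Ctx C R X Y) (k : Prop) : Sim (Ctx C R) k P Q := by
  intro μ X _ hX
  cases μ with
  | out a b =>
    obtain ⟨Q', hQ, hU⟩ := h _ _ hX.spec (Set.empty_disjoint _)
    exact ⟨Q', hQ.spec, hT _ _ hU⟩
  | tau =>
    obtain ⟨Q', hQ, hU⟩ := h _ _ hX.spec (Set.empty_disjoint _)
    exact ⟨Q', hQ.spec, hT _ _ hU⟩
  | inp a =>
    intro c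
    obtain ⟨Q', hQ, hU⟩ := h _ _ (hX.spec c) (Set.empty_disjoint _)
    obtain ⟨M, hM, rfl⟩ := hQ.spec
    exact ⟨M, hM, hT _ _ hU⟩
  | bout a =>
    obtain ⟨c, hcP, hcQ, -⟩ := exists_fresh P Q 0
    obtain ⟨Q', hQ, hU⟩ := h _ _ (hX.spec c hcP) (Set.disjoint_singleton_left.2 hcQ)
    obtain ⟨-, M, hM, rfl⟩ := hQ.spec
    exact ⟨M, hM, (hT _ _ hU).of_inst (hX.notMem_fn_bout hcP) (hM.notMem_fn_bout hcQ)⟩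

theorem Sim.mem_s {P Q : Proc} (h : Sim (Ctx C R) True P Q) :
    (P, Q) ∈ s {X | Ctx C R X.1 X.2} := by
  intro μ X hX hd
  have hX := hX.spec
  cases μ with
  | out a b =>
    obtain ⟨M, hM, hU⟩ := h _ _ (by simp) hX
    exact ⟨M, hM.spec, hU⟩
  | tau =>
    obtain ⟨M, hM, hU⟩ := h _ _ (by simp) hX
    exact ⟨M, hM.spec, hU⟩
  | inp a c =>
    obtain ⟨N, hN, rfl⟩ := hX
    obtain ⟨M, hM, hU⟩ := h _ _ (by simp) hN c
    exact ⟨_, hM.spec c, hU⟩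
  | bout a c =>
    obtain ⟨hc, N, hN, rfl⟩ := hX
    obtain ⟨M, hM, hU⟩ := h _ _ (by simp) hN
    have hcQ : c ∉ Q.fn := Set.disjoint_singleton_left.1 hd
    exact ⟨_, hM.spec c hcQ, hU.inst (hN.notMem_fn_bout hc) (hM.notMem_fn_bout hcQ)⟩

/-- The contextual closure of `R` progresses to itself if `R` does, provided that substitution
instances of processes in `C` do. -/
theorem Ctx.sim {k : Prop}
    (hR : ∀ P Q, (P, Q) ∈ R → Sim (Ctx C R) k P Q ∧ Sim (Ctx C R) k Q P)
    (hsub : ∀ P ∈ C, ∀ Q ∈ C, Ctx C R P Q → Sim (Ctx C R) k P Q →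
      ∀ σ, Sim (Ctx C R) k (P.subst σ) (Q.subst σ))
    {P Q : Proc} (h : Ctx C R P Q) : Sim (Ctx C R) k P Q ∧ Sim (Ctx C R) k Q P := by
  induction h with
  | base h => exact hR _ _ h
  | bisim h =>
    have h := bisimilarity_subset_b h
    exact ⟨.of_mem_s h.1 (fun X Y => .bisim) k,
      .of_mem_s (T := conv bisimilarity) h.2 (fun X Y h => .symm (.bisim h)) k⟩
  | symm _ ih => exact ih.symm
  | trans _ _ ih₁ ih₂ => exact ⟨ih₁.1.trans ih₂.1, ih₂.2.trans ih₁.2⟩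
  | rename _ hσ ih => exact ⟨ih.1.rename hσ, ih.2.rename (by rwa [Set.union_comm])⟩
  | sub σ h hP hQ ih =>
    exact ⟨hsub _ hP _ hQ h ih.1 σ, hsub _ hQ _ hP h.symm ih.2 σ⟩
  | res _ ih => exact ⟨ih.1.res, ih.2.res⟩
  | par h₁ h₂ ih₁ ih₂ =>
    exact ⟨ih₁.1.par ih₂.1 h₁ h₂, ih₁.2.par ih₂.2 h₁.symm h₂.symm⟩
  | sum _ _ ih₁ ih₂ => exact ⟨ih₁.1.sum ih₂.1, ih₁.2.sum ih₂.2⟩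
  | rep h ih => exact ⟨ih.1.rep h, ih.2.rep h.symm⟩
  | tau h =>
    constructor
    all_goals
      rintro μ X - (_ | _)
    · exact ⟨_, .tau _, h⟩
    · exact ⟨_, .tau _, h.symm⟩
  | out a b h =>
    constructor
    all_goals
      rintro μ X - (_ | _)
    · exact ⟨_, .out a b _, h⟩
    · exact ⟨_, .out a b _, h.symm⟩
  | input a b h hP hQ => exact ⟨.input h hP hQ a b, .input h.symm hQ hP a b⟩

theorem Ctx.subset_b (h : ∀ P Q, Ctx C R P Q → Sim (Ctx C R) True P Q) :
    {X | Ctx C R X.1 X.2} ⊆ b {X | Ctx C R X.1 X.2} := by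
  rintro ⟨P, Q⟩ hX
  exact ⟨(h P Q hX).mem_s, s_mono (fun _ => .symm) (h Q P hX.symm).mem_s⟩

/-! ### Laws for parallel composition and restriction -/

/-- Commutativity of parallel composition, scope extrusion and exchange of restrictions. -/
inductive Scope : Proc → Proc → Prop
  | comm (P Q : Proc) : Scope (.par P Q) (.par Q P)
  | extrude (P Q : Proc) : Scope (.par (.res P) Q) (.res (.par P (Q.subst Nat.succ)))
  | exchange (P : Proc) : Scope (.res (.res P)) (.res (.res (P.subst swap)))
  | symm {P Q : Proc} : Scope P Q → Scope Q P

/-- The contextual closure of the laws `Scope`. -/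
abbrev StructCong : Proc → Proc → Prop := Ctx ∅ {X | Scope X.1 X.2}

theorem StructCong.of_scope {P Q : Proc} (h : Scope P Q) : StructCong P Q := .base h

theorem Proc.succ_lift (P : Proc) (σ : ℕ → ℕ) :
    (P.subst Nat.succ).subst (lift σ) = (P.subst σ).subst Nat.succ := by
  rw [Proc.subst_subst, Proc.subst_subst]
  rfl

/-- Inputs instantiate residuals with arbitrary names, while `Ctx ∅` offers only injective
renamings; so the laws themselves have to be stable under all substitutions. -/
theorem Scope.subst {P Q : Proc} (h : Scope P Q) (σ : ℕ → ℕ) :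
    Scope (P.subst σ) (Q.subst σ) := by
  induction h with
  | comm P Q => exact .comm _ _
  | extrude P Q =>
    have h := Scope.extrude (P.subst (lift σ)) (Q.subst σ)
    rwa [← Proc.succ_lift] at h
  | exchange P =>
    have h := Scope.exchange (P.subst (lift (lift σ)))
    have e : (P.subst (lift (lift σ))).subst swap = (P.subst swap).subst (lift (lift σ)) := by
      rw [Proc.subst_subst, Proc.subst_subst]
      congr 1
      funext x
      rcases x with _ | _ | x <;> rfl
    rwa [e] at h
  | symm _ ih => exact ih.symm

theorem Answer.of_scope {Q N M : Proc} {μ : Lab} (hQ : Step Q μ M) (h : Scope N M) :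
    Answer StructCong Q μ N := by
  cases μ
  case inp =>
    intro c
    refine ⟨M, hQ, ?_⟩
    rw [Proc.inst_eq, Proc.inst_eq]
    exact .of_scope (h.subst _)
  all_goals exact ⟨M, hQ, .of_scope h⟩

theorem Answer.of_step {Q N : Proc} {μ : Lab} (hQ : Step Q μ N) : Answer StructCong Q μ N := by
  cases μ
  case inp => exact fun c => ⟨N, hQ, .refl _⟩
  all_goals exact ⟨N, hQ, .refl _⟩

theorem Lab.exch_wk_succ (μ : Lab) : μ.exch ∘ μ.wk ∘ Nat.succ = Nat.succ ∘ μ.wk := by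
  cases μ <;> rfl

theorem Lab.exch_wk (μ : Lab) : μ.exch ∘ μ.wk = lift μ.wk := by
  cases μ <;> funext x <;> rcases x with _ | x <;> rfl

theorem Lab.exch_ext_succ (μ : Lab) : μ.exch ∘ μ.ext Nat.succ = Nat.succ := by
  cases μ <;> funext x <;> rcases x with _ | x <;> rfl

theorem Step.extrudeL {A A' : Proc} {μ : Lab} (h : Step A (μ.subst Nat.succ) A') (B : Proc) :
    Step (.res (.par A (B.subst Nat.succ))) μ
      (.res (.par (A'.subst μ.exch) ((B.subst μ.wk).subst Nat.succ))) := by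
  have h := (Step.parL (B.subst Nat.succ) h).res
  simp only [Lab.wk_subst, Proc.subst, Proc.subst_subst, Lab.exch_wk_succ] at h
  rwa [Proc.subst_subst]

theorem Step.extrudeR {B B' : Proc} {μ : Lab} (h : Step B μ B') (A : Proc) :
    Step (.res (.par A (B.subst Nat.succ))) μ
      (.res (.par (A.subst (lift μ.wk)) (B'.subst Nat.succ))) := by
  have h := (Step.parR A (h.subst Nat.succ)).res
  simpa only [Lab.wk_subst, Proc.subst, Proc.subst_subst, Lab.exch_wk, Lab.exch_ext_succ] using h

/-- A close step adds a restriction outside the old one. Extruding the old one leaves the two in the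
wrong order. -/
theorem StructCong.extrude_exchange (N M : Proc) :
    StructCong (.res (.par (.res (N.subst swap)) M))
      (.res (.res (.par N (M.subst (lift Nat.succ))))) := by
  have h₁ : StructCong _ _ := (StructCong.of_scope (.extrude (N.subst swap) M)).res
  have h₂ : StructCong _ _ :=
    .of_scope (.exchange (.par (N.subst swap) (M.subst Nat.succ)))
  have e₁ : (N.subst swap).subst swap = N := by
    rw [Proc.subst_subst]
    exact Proc.subst_eq_self fun x _ => swap_swap x
  have e₂ : (M.subst Nat.succ).subst swap = M.subst (lift Nat.succ) := by
    rw [Proc.subst_subst]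
    congr 1
    funext x
    cases x <;> rfl
  rw [Proc.subst, e₁, e₂] at h₂
  exact h₁.trans h₂

theorem sim_comm (P Q : Proc) : Sim StructCong True (.par P Q) (.par Q P) := by
  intro μ X _ hX
  cases hX with
  | parL _ h => exact .of_scope (.parR _ h) (.comm _ _)
  | parR _ h => exact .of_scope (.parL _ h) (.comm _ _)
  | commL h₁ h₂ => exact .of_scope (.commR h₂ h₁) (.comm _ _)
  | commR h₁ h₂ => exact .of_scope (.commL h₂ h₁) (.comm _ _)
  | closeL h₁ h₂ => exact ⟨_, .closeR h₂ h₁, (StructCong.of_scope (.comm _ _)).res⟩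
  | closeR h₁ h₂ => exact ⟨_, .closeL h₂ h₁, (StructCong.of_scope (.comm _ _)).res⟩

theorem Proc.lift_succ_inst_zero (M : Proc) : (M.subst (lift Nat.succ)).inst 0 = M := by
  rw [Proc.inst_eq, Proc.subst_subst]
  exact Proc.subst_eq_self fun x _ => by cases x <;> rfl

theorem sim_extrude (A B : Proc) :
    Sim StructCong True (.par (.res A) B) (.res (.par A (B.subst Nat.succ))) := by
  intro μ X _ hX
  cases hX with
  | parL _ h =>
    cases h with
    | res h => exact .of_scope (h.extrudeL B) (.extrude _ _)
    | opn h =>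
      have h := Step.opn (Step.parL (B.subst Nat.succ) h)
      simp only [Lab.wk, Proc.subst_id] at h
      exact .of_step h
  | parR _ h => exact .of_scope (h.extrudeR A) (.extrude _ _)
  | @commL _ _ a b _ _ h₁ h₂ =>
    cases h₁ with
    | @res _ _ N h₁ =>
      have h := Step.res (μ := .tau) (Step.commL h₁ (h₂.subst Nat.succ))
      simp only [Lab.exch, Proc.subst_id] at h ⊢
      rw [Proc.res_swap_inst]
      exact .of_scope h (.extrude _ _)
  | @commR _ _ a b _ N h₁ h₂ =>
    cases h₁ with
    | res h₁ =>
      have h := Step.res (μ := .tau) (Step.commR h₁ (h₂.subst Nat.succ))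
      simp only [Lab.exch, Proc.subst_id, Lab.ext, ← Proc.inst_subst] at h ⊢
      exact .of_scope h (.extrude _ _)
  | closeL h₁ h₂ =>
    cases h₁ with
    | res h₁ =>
      have h := Step.res (μ := .tau) (Step.closeL h₁ (h₂.subst Nat.succ))
      simp only [Lab.exch, Proc.subst_id, Lab.ext] at h ⊢
      exact ⟨_, h, .extrude_exchange _ _⟩
  | closeR h₁ h₂ =>
    cases h₁ with
    | res h₁ =>
      have h := Step.res (μ := .tau) (Step.closeR h₁ (h₂.subst Nat.succ))
      simp only [Lab.exch, Proc.subst_id, Lab.ext] at h ⊢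
      exact ⟨_, h, .extrude_exchange _ _⟩
    -- The extruded name is the restricted one, so with the restriction moved outwards the close
    -- step becomes an ordinary communication of the name `0`.
    | opn h₁ =>
      have h := Step.res (μ := .tau) (Step.commR h₁ (h₂.subst Nat.succ))
      simp only [Lab.exch, Proc.subst_id, Lab.ext, Proc.lift_succ_inst_zero] at h
      exact .of_step h

theorem Step.of_subst_succ {B X : Proc} {ν : Lab} (h : Step (B.subst Nat.succ) ν X) :
    ∃ μ B', Step B μ B' ∧ μ.subst Nat.succ = ν ∧ X = B'.subst (μ.ext Nat.succ) :=
  h.of_subst fun _ => Nat.succ_injective.injOn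

theorem sim_extrude_symm (A B : Proc) :
    Sim StructCong True (.res (.par A (B.subst Nat.succ))) (.par (.res A) B) := by
  intro μ X _ hX
  cases hX with
  | opn h =>
    cases h with
    | parL _ h =>
      have h := Step.parL B (Step.opn h)
      simp only [Lab.wk, Proc.subst_id] at h ⊢
      exact .of_step h
    | parR _ h =>
      obtain ⟨ν, B', -, hν, -⟩ := h.of_subst_succ
      cases ν <;> simp [Lab.subst] at hν
  | res h =>
    generalize hν : μ.subst Nat.succ = ν at h
    cases h with
    | parL _ h =>
      subst hν
      simp only [Lab.wk_subst, Proc.subst, Proc.subst_subst, Lab.exch_wk_succ]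
      rw [← Proc.subst_subst B]
      exact .of_scope (.parL B h.res) (Scope.extrude _ _).symm
    | parR _ h =>
      obtain ⟨κ, B', g, hκ, rfl⟩ := h.of_subst_succ
      obtain rfl := Lab.subst_succ_injective (hκ.trans hν.symm)
      subst hν
      simp only [Lab.wk_subst, Proc.subst, Proc.subst_subst, Lab.exch_wk, Lab.exch_ext_succ]
      exact .of_scope (.parR (.res A) g) (Scope.extrude _ _).symm
    | commL h₁ h₂ =>
      obtain ⟨κ, B', g₂, hκ, rfl⟩ := h₂.of_subst_succ
      cases κ <;> simp only [Lab.subst, Lab.out.injEq, reduceCtorEq] at hκ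
      obtain ⟨rfl, rfl⟩ := hκ
      cases μ <;> simp only [Lab.subst, reduceCtorEq] at hν
      have h := Step.commL (Step.res (μ := .inp _) h₁) g₂
      simp only [Lab.exch, Proc.subst_id, Proc.res_swap_inst] at h ⊢
      exact .of_scope h (Scope.extrude _ _).symm
    | @commR _ _ _ b _ _ h₁ h₂ =>
      obtain ⟨κ, N, g₂, hκ, rfl⟩ := h₂.of_subst_succ
      cases κ <;> simp only [Lab.subst, Lab.inp.injEq, reduceCtorEq] at hκ
      subst hκ
      cases μ <;> simp only [Lab.subst, reduceCtorEq] at hν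
      -- If the restricted name `0` itself is sent, the matching step opens and closes its scope;
      -- any other name is communicated past the restriction.
      cases b with
      | zero =>
        have h := Step.closeR (Step.opn h₁) g₂
        simp only [Lab.exch, Proc.subst_id, Lab.ext, Proc.lift_succ_inst_zero]
        exact .of_step h
      | succ b =>
        have h := Step.commR (Step.res (μ := .out _ _) h₁) g₂
        simp only [Lab.exch, Proc.subst_id, Lab.ext] at h ⊢
        rw [← Nat.succ_eq_add_one, ← Proc.inst_subst]
        exact .of_scope h (Scope.extrude _ _).symm
    | closeL h₁ h₂ =>
      obtain ⟨κ, B', g₂, hκ, rfl⟩ := h₂.of_subst_succ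
      cases κ <;> simp only [Lab.subst, Lab.bout.injEq, reduceCtorEq] at hκ
      subst hκ
      cases μ <;> simp only [Lab.subst, reduceCtorEq] at hν
      simp only [Lab.exch, Proc.subst_id]
      exact ⟨_, .closeL (Step.res (μ := .inp _) h₁) g₂, (StructCong.extrude_exchange _ _).symm⟩
    | closeR h₁ h₂ =>
      obtain ⟨κ, B', g₂, hκ, rfl⟩ := h₂.of_subst_succ
      cases κ <;> simp only [Lab.subst, Lab.inp.injEq, reduceCtorEq] at hκ
      subst hκ
      cases μ <;> simp only [Lab.subst, reduceCtorEq] at hν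
      simp only [Lab.exch, Proc.subst_id]
      exact ⟨_, .closeR (Step.res (μ := .bout _) h₁) g₂, (StructCong.extrude_exchange _ _).symm⟩

theorem Lab.subst_succ_succ_swap (μ : Lab) :
    ((μ.subst Nat.succ).subst Nat.succ).subst swap = (μ.subst Nat.succ).subst Nat.succ := by
  cases μ <;> rfl

/-- For labels with a binder this is the braid relation for adjacent transpositions of three
binders. -/
theorem Lab.exch_braid (μ : Lab) :
    swap ∘ lift μ.exch ∘ μ.exch = lift μ.exch ∘ μ.exch ∘ μ.ext swap := by
  cases μ <;> funext x <;> rcases x with _ | _ | _ | x <;> rfl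

theorem sim_exchange (A : Proc) :
    Sim StructCong True (.res (.res A)) (.res (.res (A.subst swap))) := by
  intro μ X _ hX
  cases hX with
  | opn h =>
    cases h with
    | @res _ _ A' h =>
      have h := Step.res (μ := .bout _) (Step.opn (h.subst swap))
      have e : (A'.subst swap).subst swap = A' := by
        rw [Proc.subst_subst]
        exact Proc.subst_eq_self fun x _ => swap_swap x
      simp only [Lab.subst, Lab.exch, Lab.ext, e, Proc.subst_id] at h ⊢
      exact .of_step h
  | res h =>
    generalize hν : μ.subst Nat.succ = ν at h
    cases h with
    | opn h =>
      cases μ <;> simp only [Lab.subst, Lab.bout.injEq, reduceCtorEq] at hν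
      subst hν
      have h := Step.opn (Step.res (μ := .out _ 0) (h.subst swap))
      simp only [Lab.exch, Lab.ext, Proc.subst_id] at h
      exact .of_step h
    | @res _ _ A' h =>
      subst hν
      have h := h.subst swap
      rw [Lab.subst_succ_succ_swap] at h
      have h := h.res.res
      simp only [Lab.exch_subst, Lab.ext_subst, Proc.subst, Proc.subst_subst] at h ⊢
      refine .of_scope h ?_
      have h' := Scope.exchange (A'.subst (lift μ.exch ∘ μ.exch))
      rwa [Proc.subst_subst, Lab.exch_braid] at h'

theorem Scope.sim {P Q : Proc} (h : Scope P Q) :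
    Sim StructCong True P Q ∧ Sim StructCong True Q P := by
  induction h with
  | comm P Q => exact ⟨sim_comm P Q, sim_comm Q P⟩
  | extrude P Q => exact ⟨sim_extrude P Q, sim_extrude_symm P Q⟩
  | exchange P =>
    refine ⟨sim_exchange P, ?_⟩
    have h := sim_exchange (P.subst swap)
    rwa [Proc.subst_subst P, Proc.subst_eq_self (σ := swap ∘ swap) fun x _ => swap_swap x] at h
  | symm _ ih => exact ih.symm

/-- This is an instance of `Ctx.sim` over the empty set of processes, where the demand on
substitution instances is void. -/
theorem StructCong.mem_bisimilarity {P Q : Proc} (h : StructCong P Q) :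
    (P, Q) ∈ bisimilarity :=
  ⟨_, Ctx.subset_b fun _ _ h => (Ctx.sim (fun _ _ h => Scope.sim h)
    (fun _ hP => hP.elim) h).1, h⟩

/-! ### Communications made possible by a substitution -/

/-- `X` is, up to structural congruence, the residual of a communication of `Pσ` on two
different names of `P` that `σ` identifies. -/
inductive Aliased (σ : ℕ → ℕ) (P X : Proc) : Prop
  | out (a b c : ℕ) (P₁ N : Proc) : a ≠ c → σ a = σ c → Step P (.out a b) P₁ →
      Step P₁ (.inp c) N → StructCong X ((N.inst b).subst σ) → Aliased σ P X
  -- In `P₁` the extruded name is `0`: the free subject `c` reads `c + 1`, and the name received is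
  -- `0`.
  | bout (a c : ℕ) (P₁ N : Proc) : a ≠ c → σ a = σ c → Step P (.bout a) P₁ →
      Step P₁ (.inp (c + 1)) N → StructCong X ((Proc.res (N.inst 0)).subst σ) → Aliased σ P X

theorem StructCong.extrude (A B : Proc) (σ : ℕ → ℕ) :
    StructCong (.par (.res (A.subst (lift σ))) (B.subst σ))
      ((Proc.res (.par A (B.subst Nat.succ))).subst σ) := by
  have h := StructCong.of_scope (.extrude (A.subst (lift σ)) (B.subst σ))
  rwa [← Proc.succ_lift] at h

namespace Aliased

variable {σ : ℕ → ℕ} {P X : Proc}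

theorem map {P Q : Proc} (h : Aliased σ P X) (hPQ : ∀ μ Y, Step P μ Y → Step Q μ Y) :
    Aliased σ Q X := by
  cases h with
  | out a b c P₁ N hac hσ h₁ h₂ hX => exact .out a b c P₁ N hac hσ (hPQ _ _ h₁) h₂ hX
  | bout a c P₁ N hac hσ h₁ h₂ hX => exact .bout a c P₁ N hac hσ (hPQ _ _ h₁) h₂ hX

theorem parL (h : Aliased σ P X) (Q : Proc) : Aliased σ (.par P Q) (.par X (Q.subst σ)) := by
  cases h with
  | out a b c P₁ N hac hσ h₁ h₂ hX =>
    refine .out a b c _ _ hac hσ (.parL Q h₁) (.parL _ h₂) ?_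
    simp only [Lab.wk, Proc.subst_id, Proc.par_inst, Proc.succ_inst]
    exact hX.par (.refl _)
  | bout a c P₁ N hac hσ h₁ h₂ hX =>
    refine .bout a c _ _ hac hσ (.parL Q h₁) (.parL _ h₂) ?_
    simp only [Lab.wk, Proc.par_inst, Proc.succ_inst]
    exact (hX.par (.refl _)).trans (StructCong.extrude _ _ _)

theorem parR (h : Aliased σ P X) (Q : Proc) : Aliased σ (.par Q P) (.par (Q.subst σ) X) := by
  cases h with
  | out a b c P₁ N hac hσ h₁ h₂ hX =>
    refine .out a b c _ _ hac hσ (.parR Q h₁) (.parR _ h₂) ?_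
    simp only [Lab.wk, Proc.subst_id, Proc.par_inst, Proc.succ_inst]
    exact Ctx.par (.refl _) hX
  | bout a c P₁ N hac hσ h₁ h₂ hX =>
    refine .bout a c _ _ hac hσ (.parR Q h₁) (.parR _ h₂) ?_
    simp only [Lab.wk, Proc.par_inst, Proc.succ_inst]
    refine (StructCong.of_scope (.comm _ _)).trans ((hX.par (.refl _)).trans
      ((StructCong.extrude _ _ _).trans ?_))
    exact (StructCong.of_scope (.comm _ _)).res

theorem res (h : Aliased (lift σ) P X) : Aliased σ (.res P) (.res X) := by
  -- `lift σ` identifies `0` with no other name, so two different identified subjects both come from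
  -- outside the restriction.
  have ne_zero {a c : ℕ} (hac : a ≠ c) (hσ : lift σ a = lift σ c) :
      ∃ a' c', a = a' + 1 ∧ c = c' + 1 ∧ a' ≠ c' ∧ σ a' = σ c' := by
    cases a <;> cases c <;> simp_all
  cases h with
  | out a b c P₁ N hac hσ h₁ h₂ hX =>
    obtain ⟨a, c, rfl, rfl, hac, hσ⟩ := ne_zero hac hσ
    cases b with
    -- Sending the restricted name turns a free output into a bound one.
    | zero => exact .bout a c _ _ hac hσ (.opn h₁) h₂ hX.res
    | succ b =>
      have g₁ := Step.res (μ := .out _ _) h₁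
      have g₂ := Step.res (μ := .inp _) h₂
      simp only [Lab.exch, Proc.subst_id] at g₁ g₂
      refine .out a b c _ _ hac hσ g₁ g₂ ?_
      rw [Proc.res_swap_inst]
      exact hX.res
  | bout a c P₁ N hac hσ h₁ h₂ hX =>
    obtain ⟨a, c, rfl, rfl, hac, hσ⟩ := ne_zero hac hσ
    have g₁ := Step.res (μ := .bout _) h₁
    have g₂ := Step.res (μ := .inp (c + 1)) (h₂.subst swap)
    simp only [Lab.exch, Lab.ext] at g₁ g₂
    refine .bout a c _ _ hac hσ g₁ g₂ (hX.res.trans ?_)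
    have h : StructCong _ _ :=
      .of_scope ((Scope.exchange (N.inst 0)).subst σ)
    have e : (Proc.res ((N.subst (lift swap)).subst swap)).inst 0
        = .res ((N.inst 0).subst swap) := by
      rw [Proc.res_swap_inst, Proc.inst_subst]
      rfl
    rwa [e]

end Aliased

/-- Without injectivity, the two subjects of a communication may differ before `σ` is applied; this
is the only source of the second alternative. -/
theorem Step.tau_of_subst {P : Proc} {σ : ℕ → ℕ} {X : Proc} (h : Step (P.subst σ) .tau X) :
    (∃ P', Step P .tau P' ∧ X = P'.subst σ) ∨ Aliased σ P X := by
  generalize hZ : P.subst σ = Z at h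
  generalize hν : Lab.tau = ν at h
  induction h generalizing P σ with
  | inp | out | opn => cases hν
  | tau A =>
    rcases P with (_ | _ | _ | _ | _) | _ | _ | _ <;> simp [Proc.subst, GSum.subst] at hZ
    subst hZ
    exact .inl ⟨_, .tau _, rfl⟩
  | sumL H _ ih =>
    rcases P with (_ | _ | _ | _ | _) | _ | _ | _ <;> simp [Proc.subst, GSum.subst] at hZ
    obtain ⟨hG, rfl⟩ := hZ
    obtain ⟨P', h, hX⟩ | h := ih (P := .ofSum _) (congrArg _ hG) hν
    · exact .inl ⟨P', .sumL _ h, hX⟩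
    · exact .inr (h.map fun _ _ => .sumL _)
  | sumR H _ ih =>
    rcases P with (_ | _ | _ | _ | _) | _ | _ | _ <;> simp [Proc.subst, GSum.subst] at hZ
    obtain ⟨rfl, hG⟩ := hZ
    obtain ⟨P', h, hX⟩ | h := ih (P := .ofSum _) (congrArg _ hG) hν
    · exact .inl ⟨P', .sumR _ h, hX⟩
    · exact .inr (h.map fun _ _ => .sumR _)
  | rep _ ih =>
    rcases P with _ | G | _ | _ <;> simp [Proc.subst] at hZ
    subst hZ
    obtain ⟨P', h, hX⟩ | h := ih (P := .par (.rep G) (.ofSum G)) rfl hν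
    · exact .inl ⟨P', .rep h, hX⟩
    · exact .inr (h.map fun _ _ => .rep)
  | res _ ih =>
    rcases P with _ | _ | _ | P <;> simp [Proc.subst] at hZ
    subst hZ
    subst hν
    simp only [Lab.exch, Proc.subst_id]
    obtain ⟨P', h, rfl⟩ | h := ih rfl rfl
    · have h := Step.res (μ := .tau) h
      simp only [Lab.exch, Proc.subst_id] at h
      exact .inl ⟨_, h, rfl⟩
    · exact .inr h.res
  | parL _ _ ih =>
    rcases P with _ | _ | ⟨A, B⟩ | _ <;> simp [Proc.subst] at hZ
    obtain ⟨rfl, rfl⟩ := hZ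
    subst hν
    simp only [Lab.wk, Proc.subst_id]
    obtain ⟨P', h, rfl⟩ | h := ih rfl rfl
    · have h := Step.parL B h
      simp only [Lab.wk, Proc.subst_id] at h
      exact .inl ⟨_, h, rfl⟩
    · exact .inr (h.parL B)
  | parR _ _ ih =>
    rcases P with _ | _ | ⟨A, B⟩ | _ <;> simp [Proc.subst] at hZ
    obtain ⟨rfl, rfl⟩ := hZ
    subst hν
    simp only [Lab.wk, Proc.subst_id]
    obtain ⟨P', h, rfl⟩ | h := ih rfl rfl
    · have h := Step.parR A h
      simp only [Lab.wk, Proc.subst_id] at h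
      exact .inl ⟨_, h, rfl⟩
    · exact .inr (h.parR A)
  | commL h₁ h₂ =>
    rcases P with _ | _ | ⟨A, B⟩ | _ <;> simp [Proc.subst] at hZ
    obtain ⟨rfl, rfl⟩ := hZ
    obtain ⟨μ, N, g₁, hμ, rfl⟩ := h₁.of_subst (by simp)
    obtain ⟨κ, Q', g₂, hκ, rfl⟩ := h₂.of_subst (by simp)
    rcases μ with ⟨a, b⟩ | a | c | _ <;> simp only [Lab.subst, Lab.inp.injEq,
      reduceCtorEq] at hμ
    rcases κ with ⟨a, b⟩ | a | c | _ <;> simp only [Lab.subst, Lab.out.injEq,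
      reduceCtorEq] at hκ
    obtain ⟨hκ, rfl⟩ := hκ
    simp only [Lab.ext, ← Proc.inst_subst]
    by_cases hac : a = c
    · subst hac
      exact .inl ⟨_, .commL g₁ g₂, rfl⟩
    -- The two actions belong to different components, so they can be performed one after the other,
    -- the output first.
    · refine .inr (.out a b c _ _ hac (hκ.trans hμ.symm) (.parR A g₂)
        (.parL _ (by simpa only [Lab.wk, Proc.subst_id] using g₁)) ?_)
      simp only [Lab.wk, Proc.par_inst, Proc.succ_inst]
      exact .refl _
  | commR h₁ h₂ =>
    rcases P with _ | _ | ⟨A, B⟩ | _ <;> simp [Proc.subst] at hZ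
    obtain ⟨rfl, rfl⟩ := hZ
    obtain ⟨μ, N, g₁, hμ, rfl⟩ := h₁.of_subst (by simp)
    obtain ⟨κ, Q', g₂, hκ, rfl⟩ := h₂.of_subst (by simp)
    rcases μ with ⟨a, b⟩ | a | c | _ <;> simp only [Lab.subst, Lab.out.injEq,
      reduceCtorEq] at hμ
    rcases κ with ⟨a, b⟩ | a | c | _ <;> simp only [Lab.subst, Lab.inp.injEq,
      reduceCtorEq] at hκ
    obtain ⟨hμ, rfl⟩ := hμ
    simp only [Lab.ext, ← Proc.inst_subst]
    by_cases hac : a = c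
    · subst hac
      exact .inl ⟨_, .commR g₁ g₂, rfl⟩
    · refine .inr (.out a b c _ _ hac (hμ.trans hκ.symm) (.parL B g₁)
        (.parR _ (by simpa only [Lab.wk, Proc.subst_id] using g₂)) ?_)
      simp only [Lab.wk, Proc.par_inst, Proc.succ_inst]
      exact .refl _
  | closeL h₁ h₂ =>
    rcases P with _ | _ | ⟨A, B⟩ | _ <;> simp [Proc.subst] at hZ
    obtain ⟨rfl, rfl⟩ := hZ
    obtain ⟨μ, N, g₁, hμ, rfl⟩ := h₁.of_subst (by simp)
    obtain ⟨κ, M, g₂, hκ, rfl⟩ := h₂.of_subst (by simp)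
    rcases μ with ⟨a, b⟩ | a | c | _ <;> simp only [Lab.subst, Lab.inp.injEq,
      reduceCtorEq] at hμ
    rcases κ with ⟨a, b⟩ | a | c | _ <;> simp only [Lab.subst, Lab.bout.injEq,
      reduceCtorEq] at hκ
    by_cases hac : a = c
    · subst hac
      exact .inl ⟨_, .closeL g₁ g₂, rfl⟩
    · refine .inr (.bout a c _ _ hac (hκ.trans hμ.symm) (.parR A g₂)
        (.parL _ (g₁.subst Nat.succ)) ?_)
      simp only [Lab.ext, Lab.wk, Proc.par_inst, Proc.succ_inst, Proc.lift_succ_inst_zero]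
      exact .refl _
  | closeR h₁ h₂ =>
    rcases P with _ | _ | ⟨A, B⟩ | _ <;> simp [Proc.subst] at hZ
    obtain ⟨rfl, rfl⟩ := hZ
    obtain ⟨μ, N, g₁, hμ, rfl⟩ := h₁.of_subst (by simp)
    obtain ⟨κ, M, g₂, hκ, rfl⟩ := h₂.of_subst (by simp)
    rcases μ with ⟨a, b⟩ | a | c | _ <;> simp only [Lab.subst, Lab.bout.injEq,
      reduceCtorEq] at hμ
    rcases κ with ⟨a, b⟩ | a | c | _ <;> simp only [Lab.subst, Lab.inp.injEq,
      reduceCtorEq] at hκ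
    by_cases hac : a = c
    · subst hac
      exact .inl ⟨_, .closeR g₁ g₂, rfl⟩
    · refine .inr (.bout a c _ _ hac (hμ.trans hκ.symm) (.parL B g₁)
        (.parR _ (g₂.subst Nat.succ)) ?_)
      simp only [Lab.ext, Lab.wk, Proc.par_inst, Proc.succ_inst, Proc.lift_succ_inst_zero]
      exact .refl _

/-! ### Substitution instances of processes in a subcalculus -/

/-- Bodies of binders that become processes of `C` when a fresh name is substituted. -/
theorem Ctx.sub_body {N M : Proc} {b : ℕ} (h : Ctx C R (N.inst b) (M.inst b))
    (hN : b + 1 ∉ N.fn) (hM : b + 1 ∉ M.fn) (hNC : N.inst b ∈ C) (hMC : M.inst b ∈ C)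
    (σ : ℕ → ℕ) : Ctx C R (N.subst (lift σ)) (M.subst (lift σ)) := by
  -- Only the named instances lie in `C`, so one substitution applies `lift σ` and rebinds `b` at
  -- once.
  have h := h.sub (fun x => if x = b then 0 else σ x + 1) hNC hMC
  rwa [Proc.subst_inst hN (f := lift σ) (by simp) (by simp +contextual),
    Proc.subst_inst hM (f := lift σ) (by simp) (by simp +contextual)] at h

/-- Closure under transitions puts the residuals into `C`, where arbitrary substitutions are
allowed. An input therefore needs only the answer for one fresh name, later sent to `c`. -/
theorem Answer.sub (hC : IsSubcalculus C) {P Q P' : Proc} {μ : Lab} (hP : P ∈ C) (hQ : Q ∈ C)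
    (hP' : Step P μ P') (h : Answer (Ctx C R) Q μ P') (σ : ℕ → ℕ) :
    Answer (Ctx C R) (Q.subst σ) (μ.subst σ) (P'.subst (μ.ext σ)) := by
  obtain ⟨b, hbP, hbQ, -⟩ := exists_fresh P Q 0
  cases μ with
  | inp a =>
    intro c
    obtain ⟨M, hM, hU⟩ := h b
    refine ⟨_, hM.subst σ, ?_⟩
    simp only [Lab.ext]
    rw [← Proc.subst_update_inst (hP'.notMem_fn_inp hbP),
      ← Proc.subst_update_inst (hM.notMem_fn_inp hbQ)]
    exact hU.sub _ (hC _ hP _ _ (hP'.spec b)) (hC _ hQ _ _ (hM.spec b))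
  | bout a =>
    obtain ⟨M, hM, hU⟩ := h
    have hN := hP'.notMem_fn_bout hbP
    have hM' := hM.notMem_fn_bout hbQ
    exact ⟨_, hM.subst σ, (hU.inst hN hM').sub_body hN hM' (hC _ hP _ _ (hP'.spec b hbP))
      (hC _ hQ _ _ (hM.spec b hbQ)) σ⟩
  | out a b =>
    obtain ⟨M, hM, hU⟩ := h
    exact ⟨_, hM.subst σ, hU.sub σ (hC _ hP _ _ hP'.spec) (hC _ hQ _ _ hM.spec)⟩
  | tau =>
    obtain ⟨M, hM, hU⟩ := h
    exact ⟨_, hM.subst σ, hU.sub σ (hC _ hP _ _ hP'.spec) (hC _ hQ _ _ hM.spec)⟩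

theorem Sim.sub_visible (hC : IsSubcalculus C) {P Q : Proc} (hP : P ∈ C) (hQ : Q ∈ C)
    (h : Sim (Ctx C R) False P Q) (σ : ℕ → ℕ) :
    Sim (Ctx C R) False (P.subst σ) (Q.subst σ) := by
  intro ν X hν hX
  obtain ⟨μ, P', hP', rfl, rfl⟩ := hX.of_subst fun e => (hν e).elim
  exact (h μ P' (fun e => hν (by rw [e]; rfl)) hP').sub hC hP hQ hP' σ

/-- The residuals of a bound output and a subsequent input of the extruded name, with a fresh
name for the extruded one. -/
theorem Step.bout_inp_spec {P P₁ N : Proc} {a b c : ℕ} (h₁ : Step P (.bout a) P₁)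
    (h₂ : Step P₁ (.inp (c + 1)) N) (hb : b ∉ P.fn) :
    Trans P (.bout a b) (P₁.inst b) ∧ Trans (P₁.inst b) (.inp c b) ((N.inst 0).inst b) ∧
      b + 1 ∉ (N.inst 0).fn := by
  have hb₁ := h₁.notMem_fn_bout hb
  refine ⟨h₁.spec b hb, ?_, ?_⟩
  -- Receiving the bound name and then calling it `b` amounts to calling it `b` first and then
  -- receiving `b`.
  · have h := (h₂.subst (instFun b)).spec b
    rw [Lab.ext] at h
    rwa [Proc.inst_eq b, Proc.inst_eq b, Proc.inst_eq 0, Proc.subst_subst, ← Proc.inst_eq b P₁,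
      show instFun b ∘ instFun 0 = instFun b ∘ lift (instFun b) by
        funext x
        rcases x with _ | x <;> rfl, ← Proc.subst_subst, ← Proc.inst_eq]
  · intro h
    obtain h | h := N.fn_inst_subset 0 h
    · exact Nat.succ_ne_zero b h
    · exact hb₁ (h₂.fn_residual h _ rfl)

theorem Sim.sub (hC : IsSubcalculus C) (hacp : AliasedCommunication C)
    (hvis : ∀ P Q, Ctx C R P Q → Sim (Ctx C R) False P Q) {P Q : Proc} (hP : P ∈ C) (hQ : Q ∈ C)
    (h : Sim (Ctx C R) True P Q) (σ : ℕ → ℕ) : Sim (Ctx C R) True (P.subst σ) (Q.subst σ) := by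
  intro ν X _ hX
  by_cases hν : ν = .tau
  · subst hν
    obtain ⟨P', hP', rfl⟩ | hX := hX.tau_of_subst
    · exact (h .tau P' (by simp) hP').sub hC hP hQ hP' σ
    · cases hX with
      | out a b c P₁ N _ hσ h₁ h₂ hX =>
        obtain ⟨Q₁, hQ₁, hU₁⟩ := h _ _ (by simp) h₁
        -- The pair `P₁`, `Q₁` is just some pair in the closure; its visible transitions are covered
        -- by `hvis`, whereas `h` speaks of `P` and `Q` only.
        obtain ⟨M, hM, hU⟩ := hvis _ _ hU₁ _ _ (by simp) h₂ b
        obtain ⟨Z, hZ, hZM⟩ := (hacp Q hQ a b c Q₁ (M.inst b) σ hσ).1 hQ₁.spec (hM.spec b)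
        refine ⟨Z, hZ.spec, (Ctx.bisim hX.mem_bisimilarity).trans
          ((hU.sub σ ?_ ?_).trans (Ctx.bisim hZM).symm)⟩
        · exact hC _ (hC _ hP _ _ h₁.spec) _ _ (h₂.spec b)
        · exact hC _ (hC _ hQ _ _ hQ₁.spec) _ _ (hM.spec b)
      | bout a c P₁ N _ hσ h₁ h₂ hX =>
        obtain ⟨Q₁, hQ₁, hU₁⟩ := h _ _ (by simp) h₁
        -- The answer is taken for the extruded name, which is `0` in the body.
        obtain ⟨M, hM, hU⟩ := hvis _ _ hU₁ _ _ (by simp) h₂ 0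
        obtain ⟨b, hbP, hbQ, hbc⟩ := exists_fresh P Q c
        obtain ⟨t₁, t₂, hbN⟩ := h₁.bout_inp_spec h₂ hbP
        obtain ⟨u₁, u₂, hbM⟩ := hQ₁.bout_inp_spec hM hbQ
        obtain ⟨Z, hZ, hZM⟩ := (hacp Q hQ a b c _ _ σ hσ).2 hbc.symm u₁ u₂
        rw [Proc.nu_inst hbM] at hZM
        exact ⟨Z, hZ.spec, (Ctx.bisim hX.mem_bisimilarity).trans
          (((hU.inst hbN hbM).sub_body hbN hbM (hC _ (hC _ hP _ _ t₁) _ _ t₂)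
            (hC _ (hC _ hQ _ _ u₁) _ _ u₂) σ).res.trans (Ctx.bisim hZM).symm)⟩
  · obtain ⟨μ, P', hP', rfl, rfl⟩ := hX.of_subst fun e => (hν e).elim
    exact (h μ P' (by simp) hP').sub hC hP hQ hP' σ

/-! ### Soundness -/

theorem Ctx.nus {P Q : Proc} (h : Ctx C R P Q) (l : List ℕ) :
    Ctx C R (Proc.nus l P) (Proc.nus l Q) := by
  induction l with
  | nil => exact h
  | cons a l ih => exact (ih.rename_of_injective (closeFun_injective a)).res

/-- The bound by `C ×ˢ C` supplies the memberships that the closure demands for substitutions and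
input prefixes. -/
theorem fullContext_subset_ctx {S : Rel} (hSC : S ⊆ C ×ˢ C)
    (hS : S ⊆ {X | Ctx C R X.1 X.2}) : fullContext C S ⊆ {X | Ctx C R X.1 X.2} := by
  rintro ⟨X, Y⟩ ⟨((((((((((h | h) | h) | h) | h) | h) | h) | h) | h) | h) | h), -⟩
  · obtain ⟨P, Q, hP, h, hQ⟩ := h
    exact (Ctx.bisim hP).trans ((show Ctx C R P Q from hS h).trans (Ctx.bisim hQ).symm)
  · exact hS h
  · obtain ⟨P, h⟩ := h
    cases h
    exact .refl _
  · obtain ⟨P, Q, σ, h, e⟩ := h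
    cases e
    exact .sub σ (hS h) (hSC h).1 (hSC h).2
  · obtain ⟨P, Q, l, h, e⟩ := h
    cases e
    exact .nus (hS h) l
  · obtain ⟨P, Q, P', Q', h, h', e⟩ := h
    cases e
    exact .par (hS h) (hS h')
  · obtain ⟨G₁, G₂, G₁', G₂', h, h', e⟩ := h
    cases e
    exact .sum (hS h) (hS h')
  · obtain ⟨G, G', h, e⟩ := h
    cases e
    exact .rep (hS h)
  · obtain ⟨P, Q, h, e⟩ := h
    cases e
    exact .tau (hS h)
  · obtain ⟨P, Q, a, b, h, e⟩ := h
    cases e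
    exact Ctx.out a b (hS h)
  · obtain ⟨P, Q, a, b, h, e⟩ := h
    cases e
    exact .input a b (hS h) (hSC h).1 (hSC h).2

theorem omega_fullContext_subset_ctx (hR : R ⊆ C ×ˢ C) :
    omega (fullContext C) R ⊆ {X | Ctx C R X.1 X.2} := by
  have key (n : ℕ) : (fullContext C)^[n] R ⊆ C ×ˢ C ∩ {X | Ctx C R X.1 X.2} := by
    induction n with
    | zero => exact fun X hX => ⟨hR hX, .base hX⟩
    | succ n ih =>
      rw [Function.iterate_succ_apply']
      exact Set.subset_inter Set.inter_subset_right
        (fullContext_subset_ctx (ih.trans Set.inter_subset_left)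
          (ih.trans Set.inter_subset_right))
  exact Set.iUnion_subset fun n => (key n).trans Set.inter_subset_right

theorem ctx_subset_b (hC : IsSubcalculus C) (hacp : AliasedCommunication C)
    (hR : R ⊆ b {X | Ctx C R X.1 X.2}) :
    {X | Ctx C R X.1 X.2} ⊆ b {X | Ctx C R X.1 X.2} := by
  have base (k : Prop) (P Q : Proc) (h : (P, Q) ∈ R) :
      Sim (Ctx C R) k P Q ∧ Sim (Ctx C R) k Q P :=
    ⟨.of_mem_s (hR h).1 (fun _ _ h => h) k, .of_mem_s (hR h).2 (fun _ _ => .symm) k⟩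
  -- With internal transitions excluded, the substitution case does not meet newly created
  -- communications.
  have hvis (P Q : Proc) (h : Ctx C R P Q) : Sim (Ctx C R) False P Q :=
    (Ctx.sim (base False) (fun _ hP _ hQ _ h σ => h.sub_visible hC hP hQ σ) h).1
  exact Ctx.subset_b fun P Q h =>
    (Ctx.sim (base True) (fun _ hP _ hQ _ h σ => h.sub hC hacp hvis hP hQ σ) h).1

/-- Closure under transitions keeps both residuals in `C`. -/
theorem s_inter_prod (hC : IsSubcalculus C) {T : Rel} : s T ∩ C ×ˢ C ⊆ s (T ∩ C ×ˢ C) := by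
  rintro ⟨P, Q⟩ ⟨h, hP, hQ⟩ μ P' hP' hd
  obtain ⟨Q', hQ', hT⟩ := h μ P' hP' hd
  exact ⟨Q', hQ', hT, hC _ hP _ _ hP', hC _ hQ _ _ hQ'⟩

theorem b_inter_prod (hC : IsSubcalculus C) {T : Rel} : b T ∩ C ×ˢ C ⊆ b (T ∩ C ×ˢ C) := by
  rintro ⟨P, Q⟩ ⟨⟨h, h'⟩, hP, hQ⟩
  exact ⟨s_inter_prod hC ⟨h, hP, hQ⟩,
    s_mono (S := conv (T ∩ C ×ˢ C)) (fun _ hX => ⟨hX.1, hX.2.2, hX.2.1⟩)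
      (s_inter_prod hC ⟨h', hQ, hP⟩)⟩

end PiCalc

theorem theoremt (C : Set PiCalc.Proc) (hclosed : PiCalc.IsSubcalculus C)
    (hacp : PiCalc.AliasedCommunication C) :
    PiCalc.Sound C PiCalc.bbar (PiCalc.omega (PiCalc.fullContext C)) := by
  -- The closure also relates processes outside `C`, so it is cut down to `C` only after it is known
  -- to be a bisimulation.
  refine ⟨fun R => {X | PiCalc.Ctx C R X.1 X.2} ∩ C ×ˢ C, fun R hR => ⟨?_, ?_⟩, fun R hR h => ?_⟩
  · exact fun X hX => ⟨PiCalc.Ctx.base hX, hR hX⟩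
  · exact Set.inter_subset_right
  · have hb : {X | PiCalc.Ctx C R X.1 X.2} ⊆ PiCalc.b {X | PiCalc.Ctx C R X.1 X.2} :=
      PiCalc.ctx_subset_b hclosed hacp fun X hX =>
        PiCalc.b_mono (PiCalc.omega_fullContext_subset_ctx hR) (h hX).2
    rintro X ⟨hX, hXC⟩
    exact ⟨⟨hX, hXC⟩, PiCalc.b_inter_prod hclosed ⟨hb hX, hXC⟩⟩
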